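/- **Setting.** Let $W\subseteq\mathbb R^d$ be closed and convex with $\|w\|\le R$ on $W$; let $\ell_1,\dots,\ell_n$ ($n\ge1$) be losses that are differentiable at the points of $W$, convex on $W$, with $0\le \ell_i\le C$, $\|\nabla\ell_i\|\le G$ on $W$ and $\nabla\ell_i$ $L$-Lipschitz on $W$. Let $\lambda_0,\rho>0$, $\tilde\lambda=\lambda_0+C/\rho$, $\mathcal X=W\times[\lambda_0,\tilde\lambda]\subset\mathbb R^{d+1}$ and, for $x=(w,\lambda)$, $$g_i(x)=e^{\ell_i(w)/\lambda},\quad g=\tfrac1n\sum_i g_i,\quad F(x)=\lambda\log g(x)+\lambda\rho,\quad F_\mu(x)=F(x)+\tfrac{\mu}{2}\|x\|^2 .$$ Let $\sigma_g,\sigma_{\nabla g}>0$ satisfy, for $x\in\mathcal X$ and $i$ uniform on $\{1,\dots,n\}$, $\mathbb E|g_i(x)-g(x)|^2\le\sigma_g^2$ and $\mathbb E\|\nabla g_i(x)-\nabla g(x)\|^2\le\sigma_{\nabla g}^2$, and put $\sigma=\max\{\sigma_g,\sigma_{\nabla g}\}$. Put $E=e^{C/\lambda_0}$, $L_g=E(\frac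 G{\lambda_0}+\frac C{\lambda_0^2})$, $L_A=E(\frac{G^2}{\lambda_0^2}+\frac L{\lambda_0})$, $L_B=L_C=E(\frac{CG}{\lambda_0^3}+\frac G{\lambda_0^2})$, $L_D=E\,\frac{C^2+2\lambda_0C}{\lambda_0^4}$, $L_{\nabla g}=\sqrt{L_A^2+L_B^2+L_C^2+L_D^2}$, $L_F=\tilde\lambda L_g^2+2L_g+\tilde\lambda L_{\nabla g}+1+\tilde\lambda$ and $c=768L_F^2$. **ASCDRO**$(\Lambda_1,\eta,\beta,T)$. From $\Lambda_1=(x_1,v_1,u_1,s_1)$, for $t=1,\dots,T$ put $x_{t+1}=\Pi_{\mathcal X}(x_t-\eta z_t)$, where, with $x_t=(w_t,\lambda_t)$ and $\bar s_t=\max\{s_t,1\}$, $$z_t=\Big(\tfrac{\lambda_t}{\bar s_t}v_t,\ \tfrac{\lambda_t}{\bar s_t}u_t+\log\bar s_t+\rho\Big)+\mu x_t ,$$ draw a uniform index $i$, independent of everything before, and put $$v_{t+1}=\partial_wg_i(x_{t+1})+(1-\beta)(v_t-\partial_wg_i(x_t)),\quad u_{t+1}=\partial_\lambda g_i(x_{t+1})+(1-\beta)(u_t-\partial_\lambda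 g_i(x_t)),\quad s_{t+1}=g_i(x_{t+1})+(1-\beta)(s_t-g_i(x_t)).$$ Return $\Lambda_\tau=(x_\tau,v_\tau,u_\tau,s_\tau)$ with $\tau$ uniform on $\{1,\dots,T\}$, independent of the samples. **RASCDRO.** Let $x_1\in\mathcal X$, $\Delta>0$, $0<\mu\le\frac12$ with $F_\mu(x_1)-\inf_{\mathcal X}F_\mu\le\Delta$. Put $\epsilon_1=\Delta$, $\epsilon_{k+1}=\epsilon_k/2$ and $$\beta_k=\min\Big\{\tfrac{\mu\epsilon_k}{c\sigma^2},\tfrac1c\Big\},\quad \eta_k=\min\Big\{\tfrac{\sqrt{\mu\epsilon_k}}{24cL_F\sigma},\tfrac1{24cL_F^2}\Big\},\quad T_k=\Big\lceil\max\Big\{\tfrac{192cL_F\sigma}{\mu^{3/2}\sqrt{\epsilon_k}},\tfrac{192cL_F^2\sigma^2}{\mu\epsilon_k},\tfrac{192cL_F^2}{\mu}\Big\}\Big\rceil .$$ Initialize $v_1,u_1,s_1$ as the averages of $\partial_wg_i(x_1),\partial_\lambda g_i(x_1),g_i(x_1)$ over $B=\lceil 48L_F^2/(\mu\epsilon_1)\rceil$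 independent uniform indices, and let stage $k=1,2,\dots$ run ASCDRO with $(\eta_k,\beta_k,T_k)$ from the tuple returned by the previous stage. The oracle complexity of $K$ stages is the number of samples drawn, $B+\sum_{k=1}^KT_k$. **Theorem.** There are an absolute constant $A_1>0$ and, for all $\lambda_0,\rho,C,G,L,\sigma_g,\sigma_{\nabla g},\Delta$ (with $C,G,L\ge0$ and the others positive), a constant $A_2>0$ depending only on these numbers, such that in every instance as above (any $d,n,R,W,\ell_i,x_1$ and $\mu$) and for every $0<\epsilon\le\Delta$ there is a number of stages $1\le K\le A_1\,(1+\log_2(\epsilon_1/\epsilon))$ for which the output $x$ of RASCDRO after $K$ stages satisfies $$\mathbb E\big[F_\mu(x)-\inf_{\mathcal X}F_\mu\big]\le\epsilon ,$$ with oracle complexity $$B+\sum_{k=1}^KT_k\ \le\ A_2\max\Big\{\frac1{\mu\epsilon},\frac1{\mu^{3/2}\sqrt\epsilon}\Big\}.$$ -/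

import Mathlib

open scoped BigOperators

noncomputable section

namespace DRO

/-- The space of model parameters `w`, with the Euclidean norm. -/
abbrev Weights (d : ℕ) : Type := EuclideanSpace ℝ (Fin d)

/-- The space `ℝ^{d+1}` of points `x = (w, λ)`, with the Euclidean norm; `x.fst` is `w` and
`x.snd` is `λ`. -/
abbrev Point (d : ℕ) : Type := WithLp 2 (Weights d × ℝ)

/-- The point `(w, λ)`. -/
def mkPoint {d : ℕ} (w : Weights d) (lam : ℝ) : Point d := WithLp.toLp 2 (w, lam)

/-- The numerical constants of the problem: the regularization `lam0` and the radius `rho` of the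
divergence constraint, the bounds `C`, `G`, `L` on the losses, their gradients and the Lipschitz
constants of their gradients, and the bounds `sigmaG`, `sigmaDG` on the standard deviations of
`g_i` and `∇ g_i`. -/
structure Params where
  lam0 : ℝ
  rho : ℝ
  C : ℝ
  G : ℝ
  L : ℝ
  sigmaG : ℝ
  sigmaDG : ℝ

namespace Params

/-- The range of the constants. -/
structure Valid (p : Params) : Prop where
  lam0_pos : 0 < p.lam0
  rho_pos : 0 < p.rho
  C_nonneg : 0 ≤ p.C
  G_nonneg : 0 ≤ p.G
  L_nonneg : 0 ≤ p.L
  sigmaG_pos : 0 < p.sigmaG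
  sigmaDG_pos : 0 < p.sigmaDG

variable (p : Params)

/-- The upper bound `λ̃ = λ₀ + C / ρ` of the box constraint on `λ`. -/
def lamMax : ℝ := p.lam0 + p.C / p.rho

/-- Lipschitz constant of the `g_i`. -/
def Lg : ℝ := Real.exp (p.C / p.lam0) * (p.G / p.lam0 + p.C / p.lam0 ^ 2)

def LA : ℝ := Real.exp (p.C / p.lam0) * (p.G ^ 2 / p.lam0 ^ 2 + p.L / p.lam0)

def LB : ℝ := Real.exp (p.C / p.lam0) * (p.C * p.G / p.lam0 ^ 3 + p.G / p.lam0 ^ 2)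

def LC : ℝ := Real.exp (p.C / p.lam0) * ((p.C * p.G + p.lam0 * p.G) / p.lam0 ^ 3)

def LD : ℝ := Real.exp (p.C / p.lam0) * ((p.C ^ 2 + 2 * p.lam0 * p.C) / p.lam0 ^ 4)

/-- Lipschitz constant of the `∇ g_i`. -/
def LDg : ℝ := Real.sqrt (p.LA ^ 2 + p.LB ^ 2 + p.LC ^ 2 + p.LD ^ 2)

/-- Smoothness constant of the objective. -/
def LF : ℝ := p.lamMax * p.Lg ^ 2 + 2 * p.Lg + p.lamMax * p.LDg + 1 + p.lamMax

/-- `σ`, that is, `σ² = max {σ_g², σ_{∇g}²}`. -/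
def sigma : ℝ := max p.sigmaG p.sigmaDG

/-- The constant `c = 768 L_F²`. -/
def c : ℝ := 768 * p.LF ^ 2

end Params

/-! ### The objective -/

/-- `g_i(w, λ) = exp (ℓ_i(w) / λ)` for a single loss `f = ℓ_i`. -/
def gi {d : ℕ} (f : Weights d → ℝ) (x : Point d) : ℝ := Real.exp (f x.fst / x.snd)

/-- The partial gradient `∂_w g_i (w, λ)`. -/
def giW {d : ℕ} (f : Weights d → ℝ) (x : Point d) : Weights d :=
  gradient (fun w => gi f (mkPoint w x.snd)) x.fst

/-- The partial derivative `∂_λ g_i (w, λ)`. -/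
def giLam {d : ℕ} (f : Weights d → ℝ) (x : Point d) : ℝ :=
  deriv (fun lam => gi f (mkPoint x.fst lam)) x.snd

/-- The full gradient `∇ g_i (w, λ)`. -/
def giGrad {d : ℕ} (f : Weights d → ℝ) (x : Point d) : Point d := mkPoint (giW f x) (giLam f x)

/-- `g(x) = (1/n) ∑ g_i(x)`, the mean over the training set. -/
def g {d n : ℕ} (loss : Fin n → Weights d → ℝ) (x : Point d) : ℝ :=
  (n : ℝ)⁻¹ * ∑ i, gi (loss i) x

/-- `∇ g(x) = (1/n) ∑ ∇ g_i(x)`. -/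
def gGrad {d n : ℕ} (loss : Fin n → Weights d → ℝ) (x : Point d) : Point d :=
  (n : ℝ)⁻¹ • ∑ i, giGrad (loss i) x

/-- `F(w, λ) = λ log g(w, λ) + λ ρ`. -/
def F {d n : ℕ} (p : Params) (loss : Fin n → Weights d → ℝ) (x : Point d) : ℝ :=
  x.snd * Real.log (g loss x) + x.snd * p.rho

/-- `F_μ(x) = F(x) + μ ‖x‖² / 2`. -/
def Fmu {d n : ℕ} (p : Params) (loss : Fin n → Weights d → ℝ) (mu : ℝ) (x : Point d) : ℝ :=
  F p loss x + mu * ‖x‖ ^ 2 / 2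

/-- The feasible set `𝒳 = W × [λ₀, λ̃]`. -/
def domain {d : ℕ} (p : Params) (W : Set (Weights d)) : Set (Point d) :=
  {x | x.fst ∈ W ∧ x.snd ∈ Set.Icc p.lam0 p.lamMax}

/-- The optimality gap `F_μ(x) - inf_𝒳 F_μ`. -/
def gap {d n : ℕ} (p : Params) (W : Set (Weights d)) (loss : Fin n → Weights d → ℝ) (mu : ℝ)
    (x : Point d) : ℝ :=
  Fmu p loss mu x - sInf (Fmu p loss mu '' domain p W)

/-! ### Assumptions -/

/-- Boundedness, Lipschitz and smoothness assumptions on the losses over a closed convex set `W`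
of model parameters. -/
structure LossAssumption {d n : ℕ} (p : Params) (R : ℝ) (W : Set (Weights d))
    (loss : Fin n → Weights d → ℝ) : Prop where
  closed : IsClosed W
  convex : Convex ℝ W
  bounded : ∀ w ∈ W, ‖w‖ ≤ R
  differentiable : ∀ i, ∀ w ∈ W, DifferentiableAt ℝ (loss i) w
  grad_le : ∀ i, ∀ w ∈ W, ‖gradient (loss i) w‖ ≤ p.G
  loss_nonneg : ∀ i, ∀ w ∈ W, 0 ≤ loss i w
  loss_le : ∀ i, ∀ w ∈ W, loss i w ≤ p.C
  smooth : ∀ i, ∀ w₁ ∈ W, ∀ w₂ ∈ W,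
    ‖gradient (loss i) w₁ - gradient (loss i) w₂‖ ≤ p.L * ‖w₁ - w₂‖

/-- The variance bounds on `g_i` and `∇ g_i`, for `i` uniform on the training set. -/
structure VarianceAssumption {d n : ℕ} (p : Params) (W : Set (Weights d))
    (loss : Fin n → Weights d → ℝ) : Prop where
  value : ∀ x ∈ domain p W,
    (n : ℝ)⁻¹ * ∑ i, (gi (loss i) x - g loss x) ^ 2 ≤ p.sigmaG ^ 2
  grad : ∀ x ∈ domain p W,
    (n : ℝ)⁻¹ * ∑ i, ‖giGrad (loss i) x - gGrad loss x‖ ^ 2 ≤ p.sigmaDG ^ 2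

/-! ### The algorithm -/

/-- The tuple `Λ = (x, v, u, s)` carried by the algorithm; `v`, `u`, `s` estimate
`∂_w g(x)`, `∂_λ g(x)`, `g(x)`. -/
structure State (d : ℕ) where
  x : Point d
  v : Weights d
  u : ℝ
  s : ℝ

/-- Euclidean projection onto a set: a nearest point of the set (unique when the set is nonempty,
closed and convex). -/
def proj {d : ℕ} (X : Set (Point d)) (y : Point d) : Point d :=
  Classical.epsilon fun z => z ∈ X ∧ ∀ z' ∈ X, ‖y - z‖ ≤ ‖y - z'‖

/-- The gradient estimator
`z = (∇f_λ(s) v, ∇f_λ(s) u + log s + ρ) + μ x`, where `∇f_λ(s) = λ / s`. The value `s` enters only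
through its projection `max s 1` onto `[1, ∞)`, a set that contains all values of `g`. -/
def direction {d : ℕ} (p : Params) (mu : ℝ) (S : State d) : Point d :=
  mkPoint ((S.x.snd / max S.s 1) • S.v)
    ((S.x.snd / max S.s 1) * S.u + Real.log (max S.s 1) + p.rho) + mu • S.x

/-- One iteration of ASCDRO, with step size `eta`, momentum `beta` and sampled loss `f = ℓ_i`:
a projected step, followed by the recursive variance-reduced update of the estimators. -/
def step {d : ℕ} (p : Params) (W : Set (Weights d)) (mu eta beta : ℝ)
    (S : State d) (f : Weights d → ℝ) : State d :=
  let x' := proj (domain p W) (S.x - eta • direction p mu S)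
  { x := x'
    v := giW f x' + (1 - beta) • (S.v - giW f S.x)
    u := giLam f x' + (1 - beta) * (S.u - giLam f S.x)
    s := gi f x' + (1 - beta) * (S.s - gi f S.x) }

/-- The states visited by ASCDRO from `S` when the sampled indices are `ξ 0, …, ξ (T-1)`:
`path … ξ t` is the state after `t` iterations, `t ≤ T`. -/
def path {d n T : ℕ} (p : Params) (W : Set (Weights d)) (loss : Fin n → Weights d → ℝ)
    (mu eta beta : ℝ) (S : State d) (ξ : Fin T → Fin n) : ℕ → State d
  | 0 => S
  | t + 1 =>
    if h : t < T then
      step p W mu eta beta (path p W loss mu eta beta S ξ t) (loss (ξ ⟨t, h⟩))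
    else path p W loss mu eta beta S ξ t

/-- The law of the output of ASCDRO with `T` iterations started at `S`: draw `T` independent
uniform indices and, independently, a uniform `τ` among the `T` iterations, and return the `τ`-th
iterate; the first iterate is `S` itself. (`T = 0` does not occur.) -/
def ascdro {d n : ℕ} [NeZero n] (p : Params) (W : Set (Weights d)) (loss : Fin n → Weights d → ℝ)
    (mu eta beta : ℝ) (T : ℕ) (S : State d) : PMF (State d) :=
  if h : T = 0 then PMF.pure S
  else
    haveI : NeZero T := ⟨h⟩
    (PMF.uniformOfFintype (Fin T → Fin n)).bind fun ξ =>
      (PMF.uniformOfFintype (Fin T)).map fun τ => path p W loss mu eta beta S ξ τ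

/-- The law of the initial state: the estimators are the averages over a mini-batch of `B`
independent uniform indices. -/
def initial {d n : ℕ} [NeZero n] (loss : Fin n → Weights d → ℝ) (B : ℕ) (x₁ : Point d) :
    PMF (State d) :=
  (PMF.uniformOfFintype (Fin B → Fin n)).map fun ξ =>
    { x := x₁
      v := (B : ℝ)⁻¹ • ∑ j, giW (loss (ξ j)) x₁
      u := (B : ℝ)⁻¹ * ∑ j, giLam (loss (ξ j)) x₁
      s := (B : ℝ)⁻¹ * ∑ j, gi (loss (ξ j)) x₁ }

/-! ### Stagewise parameters; stages are numbered from `1` -/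

/-- `ε_k`: `ε_1 = Δ` and `ε_{k+1} = ε_k / 2`. -/
def epsStage (Δ : ℝ) (k : ℕ) : ℝ := Δ / 2 ^ (k - 1)

def betaStage (p : Params) (mu Δ : ℝ) (k : ℕ) : ℝ :=
  min (mu * epsStage Δ k / (p.c * p.sigma ^ 2)) (1 / p.c)

def etaStage (p : Params) (mu Δ : ℝ) (k : ℕ) : ℝ :=
  min (Real.sqrt (mu * epsStage Δ k) / (24 * p.c * p.LF * p.sigma)) (1 / (24 * p.c * p.LF ^ 2))

/-- The number of iterations in stage `k`. -/
def lenStage (p : Params) (mu Δ : ℝ) (k : ℕ) : ℕ :=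
  ⌈max (192 * p.c * p.LF * p.sigma / (mu ^ (3 / 2 : ℝ) * Real.sqrt (epsStage Δ k)))
    (max (192 * p.c * p.LF ^ 2 * p.sigma ^ 2 / (mu * epsStage Δ k))
      (192 * p.c * p.LF ^ 2 / mu))⌉₊

/-- The size of the initial mini-batch. -/
def batchSize (p : Params) (mu Δ : ℝ) : ℕ := ⌈48 * p.LF ^ 2 / (mu * Δ)⌉₊

/-- The law of the state of RASCDRO after `K` stages, started at `x₁`. -/
def rascdro {d n : ℕ} [NeZero n] (p : Params) (W : Set (Weights d)) (loss : Fin n → Weights d → ℝ)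
    (mu Δ : ℝ) (x₁ : Point d) : ℕ → PMF (State d)
  | 0 => initial loss (batchSize p mu Δ) x₁
  | k + 1 => (rascdro p W loss mu Δ x₁ k).bind
      (ascdro p W loss mu (etaStage p mu Δ (k + 1)) (betaStage p mu Δ (k + 1))
        (lenStage p mu Δ (k + 1)))

/-- The number of samples processed by RASCDRO in `K` stages: the initial mini-batch and one sample
in every iteration of every stage. -/
def oracleCalls (p : Params) (mu Δ : ℝ) (K : ℕ) : ℕ :=
  batchSize p mu Δ + ∑ k ∈ Finset.Icc 1 K, lenStage p mu Δ k

/-- Expectation of a real function of a discrete random variable with law `q`. (All laws to which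
it is applied have finite support.) -/
def expectation {α : Type*} (q : PMF α) (φ : α → ℝ) : ℝ := ∑' a, (q a).toReal * φ a

end DRO

end

/-! Since λ log g is built from the losses by log-sum-exp and perspective, F is convex; hence F_μ is
μ-strongly convex on 𝒳, and its gradient field `gradFmu` is L_F-Lipschitz. ASCDRO is a projected
gradient method in an inexact direction z_t, and the gradient error has to be kept proportional to μ
times the current accuracy.

One number measures this error: `err`, the squared error of the pair of estimates of (∇g, g),
weighted so that ‖z - ∇F_μ‖² ≤ 2 err (`norm_direction_sub_gradFmu_sq_le`). Let P_t, a_t, D_t, r_t be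
the means of `err`, of the optimality gap, of the squared step length and of the squared distance to
the minimizer. Three one-step estimates carry the proof: P_{t+1} ≤ (1 - β)P_t + 2L_F² D_t +
2β²L_F²σ² (`mean_err_step_le`), D_t ≤ 4η(a_t - a_{t+1}) + 4η² P_t (`norm_step_sq_le`), η a_{t+1} ≤
r_t - r_{t+1} + (4η/μ) P_t (`step_gap_le`). Because 16L_F²η² ≤ β, the first two close up when summed
and bound the average of P_t; the third then bounds the average of a_t. These averages are the
expectations at the random index τ (`expectation_ascdro_le`).

The invariant after k stages is E gap ≤ Δ/2^k together with E err ≤ μ(Δ/2^k)L_F² (`rascdro_spec`).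
The estimators are handed on with the iterate, so a batch is needed only once. Counted backwards
from the last stage, the stage lengths are bounded by a geometric sequence, so the total cost
carries no logarithm (`lenStage_le`). -/

namespace DRO

open scoped RealInnerProductSpace

/-! ### Uniform averages over finite types -/

section Mean

variable {ι κ E F : Type*} [Fintype ι] [Fintype κ]

/-- The average of a function on a finite type. -/
noncomputable def mean [AddCommGroup E] [Module ℝ E] (f : ι → E) : E :=
  (Fintype.card ι : ℝ)⁻¹ • ∑ i, f i

theorem mean_add [AddCommGroup E] [Module ℝ E] (f g : ι → E) :
    mean (fun i => f i + g i) = mean f + mean g := by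
  simp [mean, Finset.sum_add_distrib]

theorem mean_sub [AddCommGroup E] [Module ℝ E] (f g : ι → E) :
    mean (fun i => f i - g i) = mean f - mean g := by
  simp [mean, Finset.sum_sub_distrib, smul_sub]

theorem mean_smul [AddCommGroup E] [Module ℝ E] (c : ℝ) (f : ι → E) :
    mean (fun i => c • f i) = c • mean f := by
  simp only [mean, ← Finset.smul_sum]
  rw [smul_comm]

theorem mean_mul_left (c : ℝ) (f : ι → ℝ) : mean (fun i => c * f i) = c * mean f :=
  mean_smul c f

theorem mean_const [AddCommGroup E] [Module ℝ E] [Nonempty ι] (a : E) :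
    mean (fun _ : ι => a) = a := by
  have h : (Fintype.card ι : ℝ) ≠ 0 := by simp
  simp only [mean, Finset.sum_const, Finset.card_univ, ← Nat.cast_smul_eq_nsmul ℝ, smul_smul]
  rw [inv_mul_cancel₀ h, one_smul]

theorem mean_mono {f g : ι → ℝ} (h : ∀ i, f i ≤ g i) : mean f ≤ mean g :=
  mul_le_mul_of_nonneg_left (Finset.sum_le_sum fun i _ => h i) (by positivity)

theorem mean_nonneg {f : ι → ℝ} (h : ∀ i, 0 ≤ f i) : 0 ≤ mean f :=
  mul_nonneg (by positivity) (Finset.sum_nonneg fun i _ => h i)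

theorem mean_le_of_forall_le [Nonempty ι] {f : ι → ℝ} {c : ℝ} (h : ∀ i, f i ≤ c) : mean f ≤ c :=
  (mean_mono h).trans_eq (mean_const c)

theorem le_mean_of_forall_le [Nonempty ι] {f : ι → ℝ} {c : ℝ} (h : ∀ i, c ≤ f i) : c ≤ mean f :=
  (mean_const c).symm.trans_le (mean_mono h)

theorem norm_mean_le [SeminormedAddCommGroup E] [NormedSpace ℝ E] (f : ι → E) :
    ‖mean f‖ ≤ mean fun i => ‖f i‖ := by
  simp only [mean, norm_smul, norm_inv, RCLike.norm_natCast, smul_eq_mul]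
  exact mul_le_mul_of_nonneg_left (norm_sum_le _ _) (by positivity)

theorem map_mean [AddCommGroup E] [Module ℝ E] [AddCommGroup F] [Module ℝ F] (φ : E →ₗ[ℝ] F)
    (f : ι → E) : φ (mean f) = mean fun i => φ (f i) := by
  simp [mean]

theorem mean_comp_equiv [AddCommGroup E] [Module ℝ E] (e : ι ≃ κ) (f : κ → E) :
    mean (fun i => f (e i)) = mean f := by
  simp [mean, Fintype.card_congr e, e.sum_comp]

theorem mean_prod [AddCommGroup E] [Module ℝ E] (f : ι × κ → E) :
    mean f = mean fun i => mean fun j => f (i, j) := by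
  simp only [mean, Fintype.card_prod, Nat.cast_mul, mul_inv, Fintype.sum_prod_type, smul_smul,
    Finset.smul_sum]

theorem mean_sum {α : Type*} (s : Finset α) (f : ι → α → ℝ) :
    mean (fun i => ∑ a ∈ s, f i a) = ∑ a ∈ s, mean fun i => f i a := by
  simp only [mean, smul_eq_mul]
  rw [Finset.sum_comm, Finset.mul_sum]

/-- Averaging over an i.i.d. family does not change if one coordinate is resampled. -/
theorem mean_resample [Nonempty κ] {α : Type*} [Fintype α] [DecidableEq α] [AddCommGroup E]
    [Module ℝ E] (a : α) (H : (α → κ) → κ → E)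
    (hH : ∀ ξ i j, H (Function.update ξ a i) j = H ξ j) :
    mean (fun ξ => H ξ (ξ a)) = mean fun ξ => mean fun i => H ξ i := by
  -- Exchanging the coordinate `ξ a` with an independent fresh sample is an involution, so it
  -- preserves uniform averages.
  let e : (α → κ) × κ ≃ (α → κ) × κ :=
    { toFun := fun q => (Function.update q.1 a q.2, q.1 a)
      invFun := fun q => (Function.update q.1 a q.2, q.1 a)
      left_inv := fun q => by simp
      right_inv := fun q => by simp }
  have h := mean_comp_equiv e fun q => H q.1 (q.1 a)
  rw [mean_prod, mean_prod] at h
  simpa [e, hH, mean_const] using h.symm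

/-! ### Second moments of averages in an inner product space -/

section Variance

variable {H : Type*} [NormedAddCommGroup H] [InnerProductSpace ℝ H]

theorem mean_norm_add_sq [Nonempty ι] (a : H) (Y : ι → H) (hY : mean Y = 0) :
    mean (fun i => ‖a + Y i‖ ^ 2) = ‖a‖ ^ 2 + mean fun i => ‖Y i‖ ^ 2 := by
  have h : mean (fun i => ⟪a, Y i⟫) = 0 := by
    have := map_mean (innerₗ H a) Y
    simpa [hY] using this.symm
  simp only [norm_add_sq_real, mean_add, mean_mul_left, mean_const, h]
  ring

theorem mean_sub_mean [AddCommGroup E] [Module ℝ E] [Nonempty ι] (X : ι → E) :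
    mean (fun i => X i - mean X) = 0 := by
  rw [mean_sub, mean_const, sub_self]

theorem mean_norm_sub_mean_sq_le [Nonempty ι] (X : ι → H) :
    mean (fun i => ‖X i - mean X‖ ^ 2) ≤ mean fun i => ‖X i‖ ^ 2 := by
  have h := mean_norm_add_sq (mean X) _ (mean_sub_mean X)
  simp only [add_sub_cancel] at h
  rw [h]
  nlinarith [sq_nonneg ‖mean X‖]

/-- The variance of a sum of independent centered variables. -/
theorem mean_norm_sum_sq [Nonempty ι] (Y : ι → H) (hY : mean Y = 0) (B : ℕ) :
    mean (fun ξ : Fin B → ι => ‖∑ j, Y (ξ j)‖ ^ 2) = B * mean fun i => ‖Y i‖ ^ 2 := by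
  induction B with
  | zero => simp [mean]
  | succ B ih =>
    rw [← mean_comp_equiv (Fin.insertNthEquiv (fun _ => ι) 0), mean_prod]
    have hcomm : ∀ f : ι → (Fin B → ι) → ℝ,
        mean (fun i => mean fun ξ => f i ξ) = mean fun ξ => mean fun i => f i ξ := by
      intro f
      rw [← mean_prod (fun q : ι × (Fin B → ι) => f q.1 q.2),
        ← mean_prod (fun q : (Fin B → ι) × ι => f q.2 q.1),
        ← mean_comp_equiv (Equiv.prodComm _ _)]
      rfl
    rw [hcomm]
    have : ∀ ξ : Fin B → ι,
        mean (fun i => ‖∑ j, Y ((Fin.insertNthEquiv (fun _ => ι) 0) (i, ξ) j)‖ ^ 2)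
          = ‖∑ j, Y (ξ j)‖ ^ 2 + mean fun i => ‖Y i‖ ^ 2 := by
      intro ξ
      rw [← mean_norm_add_sq _ _ hY]
      simp [Fin.sum_univ_succ, add_comm]
    simp only [this, mean_add, ih, mean_const]
    push_cast
    ring

/-- The variance of a mini-batch average. -/
theorem mean_norm_batch_sub_sq [Nonempty ι] (X : ι → H) {B : ℕ} (hB : B ≠ 0) :
    mean (fun ξ : Fin B → ι => ‖(B : ℝ)⁻¹ • ∑ j, X (ξ j) - mean X‖ ^ 2)
      = (B : ℝ)⁻¹ * mean fun i => ‖X i - mean X‖ ^ 2 := by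
  have hB' : (B : ℝ) ≠ 0 := by exact_mod_cast hB
  have h := mean_norm_sum_sq _ (mean_sub_mean X) B
  have hpt : ∀ ξ : Fin B → ι, ‖(B : ℝ)⁻¹ • ∑ j, X (ξ j) - mean X‖ ^ 2
      = ((B : ℝ)⁻¹) ^ 2 * ‖∑ j, (X (ξ j) - mean X)‖ ^ 2 := by
    intro ξ
    have h1 : (B : ℝ)⁻¹ • ∑ j, X (ξ j) - mean X = (B : ℝ)⁻¹ • ∑ j, (X (ξ j) - mean X) := by
      rw [Finset.sum_sub_distrib, smul_sub, Finset.sum_const, Finset.card_univ, Fintype.card_fin,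
        ← Nat.cast_smul_eq_nsmul ℝ, smul_smul, inv_mul_cancel₀ hB', one_smul]
    rw [h1, norm_smul, mul_pow, Real.norm_of_nonneg (by positivity)]
  simp only [hpt, mean_mul_left, h]
  field_simp

/-- One update of a recursive variance-reduced (momentum) estimator of `mean h`. -/
theorem mean_norm_momentum_sub_sq_le [Nonempty ι] {β M V r : ℝ} (hβ0 : 0 ≤ β) (hβ1 : β ≤ 1)
    (e : H) (h h' : ι → H) (hL : ∀ i, ‖h' i - h i‖ ≤ M * r)
    (hV : mean (fun i => ‖h' i - mean h'‖ ^ 2) ≤ V) :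
    mean (fun i => ‖h' i + (1 - β) • (e - h i) - mean h'‖ ^ 2)
      ≤ (1 - β) * ‖e - mean h‖ ^ 2 + 2 * M ^ 2 * r ^ 2 + 2 * β ^ 2 * V := by
  -- The new error is (1 - β)(e - mean h) + βA_i + (1 - β)D_i with A and D centered. The cross terms
  -- with the first summand average to zero, so the old error is damped and the fresh noise enters
  -- only with weight β².
  let A : ι → H := fun i => h' i - mean h'
  let D : ι → H := fun i => (h' i - h i) - mean (fun i => h' i - h i)
  have hY : mean (fun i => β • A i + (1 - β) • D i) = 0 := by
    rw [mean_add, mean_smul, mean_smul]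
    simp only [A, D, mean_sub_mean, smul_zero, add_zero]
  have key := mean_norm_add_sq ((1 - β) • (e - mean h)) _ hY
  have heq : ∀ i, h' i + (1 - β) • (e - h i) - mean h'
      = (1 - β) • (e - mean h) + (β • A i + (1 - β) • D i) := by
    intro i
    simp only [A, D, mean_sub]
    module
  simp only [heq, key]
  have hpt : ∀ i, ‖β • A i + (1 - β) • D i‖ ^ 2
      ≤ 2 * β ^ 2 * ‖A i‖ ^ 2 + 2 * (1 - β) ^ 2 * ‖D i‖ ^ 2 := by
    intro i
    have h1 := norm_add_le (β • A i) ((1 - β) • D i)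
    rw [norm_smul, norm_smul, Real.norm_of_nonneg hβ0,
      Real.norm_of_nonneg (by linarith : 0 ≤ 1 - β)] at h1
    calc _ ≤ (β * ‖A i‖ + (1 - β) * ‖D i‖) ^ 2 := by gcongr
      _ ≤ _ := by nlinarith [sq_nonneg (β * ‖A i‖ - (1 - β) * ‖D i‖)]
  have h2 := mean_mono hpt
  rw [mean_add, mean_mul_left, mean_mul_left] at h2
  have hD : mean (fun i => ‖D i‖ ^ 2) ≤ M ^ 2 * r ^ 2 := by
    refine (mean_norm_sub_mean_sq_le _).trans (mean_le_of_forall_le fun i => ?_)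
    rw [← mul_pow]
    exact pow_le_pow_left₀ (norm_nonneg _) (hL i) 2
  have hA : mean (fun i => ‖A i‖ ^ 2) ≤ V := hV
  rw [norm_smul, Real.norm_of_nonneg (by linarith : 0 ≤ 1 - β), mul_pow]
  have hD0 : 0 ≤ mean (fun i => ‖D i‖ ^ 2) := mean_nonneg fun i => by positivity
  have h3 : (1 - β) ^ 2 ≤ 1 - β := by nlinarith
  have h4 : (1 - β) ^ 2 ≤ 1 := by nlinarith
  have h5 : 2 * (1 - β) ^ 2 * mean (fun i => ‖D i‖ ^ 2) ≤ 2 * (M ^ 2 * r ^ 2) := by nlinarith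
  have h6 : 2 * β ^ 2 * mean (fun i => ‖A i‖ ^ 2) ≤ 2 * β ^ 2 * V := by gcongr
  have h7 : (1 - β) ^ 2 * ‖e - mean h‖ ^ 2 ≤ (1 - β) * ‖e - mean h‖ ^ 2 := by gcongr
  linarith

end Variance

end Mean

/-! ### Expectations under laws of finite support -/

section Expectation

variable {α β : Type*}

theorem expectation_eq_sum (q : PMF α) (φ : α → ℝ) {s : Finset α} (hs : q.support ⊆ s) :
    expectation q φ = ∑ a ∈ s, (q a).toReal * φ a := by
  refine tsum_eq_sum fun a ha => ?_
  have : q a = 0 := by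
    by_contra h
    exact ha (hs ((PMF.mem_support_iff _ _).2 h))
  simp [this]

theorem expectation_mono {q : PMF α} (hq : q.support.Finite) {φ ψ : α → ℝ}
    (h : ∀ a ∈ q.support, φ a ≤ ψ a) : expectation q φ ≤ expectation q ψ := by
  have hs : q.support ⊆ hq.toFinset := by simp
  rw [expectation_eq_sum q φ hs, expectation_eq_sum q ψ hs]
  refine Finset.sum_le_sum fun a ha => ?_
  exact mul_le_mul_of_nonneg_left (h a (by simpa using ha)) ENNReal.toReal_nonneg

theorem expectation_add {q : PMF α} (hq : q.support.Finite) (φ ψ : α → ℝ) :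
    expectation q (fun a => φ a + ψ a) = expectation q φ + expectation q ψ := by
  have hs : q.support ⊆ hq.toFinset := by simp
  simp only [expectation_eq_sum q _ hs, mul_add, Finset.sum_add_distrib]

theorem expectation_const_mul (q : PMF α) (c : ℝ) (φ : α → ℝ) :
    expectation q (fun a => c * φ a) = c * expectation q φ := by
  simp only [expectation, mul_left_comm _ c, tsum_mul_left]

theorem expectation_const (q : PMF α) (c : ℝ) : expectation q (fun _ => c) = c := by
  rw [expectation, tsum_mul_right, ← ENNReal.tsum_toReal_eq fun a => q.apply_ne_top a,
    q.tsum_coe, ENNReal.toReal_one, one_mul]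

theorem expectation_pure (a : α) (φ : α → ℝ) : expectation (PMF.pure a) φ = φ a := by
  rw [expectation, tsum_eq_single a]
  · simp
  · intro b hb
    simp [hb]

theorem expectation_bind {q : PMF α} {f : α → PMF β} (hq : q.support.Finite)
    (hf : ∀ a ∈ q.support, (f a).support.Finite) (φ : β → ℝ) :
    expectation (q.bind f) φ = expectation q fun a => expectation (f a) φ := by
  classical
  have hs : q.support ⊆ hq.toFinset := by simp
  have hfin : (⋃ a ∈ q.support, (f a).support).Finite := hq.biUnion hf
  have ht : (q.bind f).support ⊆ hfin.toFinset := by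
    rw [PMF.support_bind]; simp
  rw [expectation_eq_sum _ _ ht, expectation_eq_sum _ _ hs]
  have h1 : ∀ a ∈ hq.toFinset, (q a).toReal * expectation (f a) φ
      = ∑ b ∈ hfin.toFinset, (q a).toReal * ((f a b).toReal * φ b) := by
    intro a ha
    rw [expectation_eq_sum (f a) φ (s := hfin.toFinset), Finset.mul_sum]
    rw [Set.Finite.coe_toFinset]
    exact Set.subset_biUnion_of_mem (u := fun a => (f a).support) (by simpa using ha)
  rw [Finset.sum_congr rfl h1, Finset.sum_comm]
  refine Finset.sum_congr rfl fun b _ => ?_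
  rw [PMF.bind_apply, tsum_eq_sum (s := hq.toFinset), ENNReal.toReal_sum, Finset.sum_mul]
  · refine Finset.sum_congr rfl fun a _ => ?_
    rw [ENNReal.toReal_mul, mul_assoc]
  · intro a _
    exact ENNReal.mul_ne_top (q.apply_ne_top a) ((f a).apply_ne_top b)
  · intro a ha
    have : q a = 0 := by
      by_contra h
      exact ha (by simpa using h)
    simp [this]

theorem expectation_uniform {ι : Type*} [Fintype ι] [Nonempty ι] (φ : ι → ℝ) :
    expectation (PMF.uniformOfFintype ι) φ = mean φ := by
  rw [expectation, tsum_fintype, mean, Finset.smul_sum]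
  simp

theorem expectation_uniform_map {ι : Type*} [Fintype ι] [Nonempty ι] (h : ι → β) (φ : β → ℝ) :
    expectation ((PMF.uniformOfFintype ι).map h) φ = mean fun i => φ (h i) := by
  rw [PMF.map, expectation_bind (Set.toFinite _), expectation_uniform]
  · simp [expectation_pure]
  · intro a _
    simp [PMF.support_pure]

theorem support_uniform_map_finite {ι : Type*} [Fintype ι] [Nonempty ι] (h : ι → β) :
    ((PMF.uniformOfFintype ι).map h).support.Finite := by
  rw [PMF.support_map]
  exact (Set.toFinite _).image h

end Expectation

/-! ### The product space -/

section Point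

variable {d : ℕ}

@[simp] theorem mkPoint_fst (w : Weights d) (l : ℝ) : (mkPoint w l).fst = w := rfl

@[simp] theorem mkPoint_snd (w : Weights d) (l : ℝ) : (mkPoint w l).snd = l := rfl

theorem mkPoint_sub (w w' : Weights d) (l l' : ℝ) :
    mkPoint w l - mkPoint w' l' = mkPoint (w - w') (l - l') := rfl

theorem mkPoint_add (w w' : Weights d) (l l' : ℝ) :
    mkPoint w l + mkPoint w' l' = mkPoint (w + w') (l + l') := rfl

theorem smul_mkPoint (c : ℝ) (w : Weights d) (l : ℝ) :
    c • mkPoint w l = mkPoint (c • w) (c * l) := rfl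

theorem sum_mkPoint {ι : Type*} (s : Finset ι) (w : ι → Weights d) (l : ι → ℝ) :
    ∑ i ∈ s, mkPoint (w i) (l i) = mkPoint (∑ i ∈ s, w i) (∑ i ∈ s, l i) := by
  classical
  induction s using Finset.induction_on with
  | empty => rfl
  | insert a s ha ih => rw [Finset.sum_insert ha, Finset.sum_insert ha, Finset.sum_insert ha, ih,
      mkPoint_add]

theorem norm_mkPoint_sq (w : Weights d) (l : ℝ) : ‖mkPoint w l‖ ^ 2 = ‖w‖ ^ 2 + |l| ^ 2 := by
  rw [WithLp.prod_norm_sq_eq_of_L2]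
  rfl

theorem norm_mkPoint_le (w : Weights d) (l : ℝ) : ‖mkPoint w l‖ ≤ ‖w‖ + |l| := by
  refine (sq_le_sq₀ (by positivity) (by positivity)).1 ?_
  rw [norm_mkPoint_sq]
  nlinarith [norm_nonneg w, abs_nonneg l]

theorem norm_point_sq (x : Point d) : ‖x‖ ^ 2 = ‖x.fst‖ ^ 2 + |x.snd| ^ 2 :=
  norm_mkPoint_sq x.fst x.snd

theorem norm_fst_le (x : Point d) : ‖x.fst‖ ≤ ‖x‖ := by
  refine (sq_le_sq₀ (by positivity) (by positivity)).1 ?_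
  rw [norm_point_sq]
  nlinarith [sq_nonneg |x.snd|]

theorem abs_snd_le (x : Point d) : |x.snd| ≤ ‖x‖ := by
  refine (sq_le_sq₀ (by positivity) (by positivity)).1 ?_
  rw [norm_point_sq]
  nlinarith [sq_nonneg ‖x.fst‖]

theorem inner_point (x y : Point d) : ⟪x, y⟫ = ⟪x.fst, y.fst⟫ + x.snd * y.snd := by
  rw [WithLp.prod_inner_apply]
  simp [mul_comm]

end Point

/-! ### Convex functions -/

/-- Restriction to the segment from `w` to `w'` reduces this to the slope inequality for a convex
function of one variable. The function need not be convex outside `W`. -/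
theorem ConvexOn.add_inner_gradient_le {E : Type*} [NormedAddCommGroup E] [InnerProductSpace ℝ E]
    [CompleteSpace E] {W : Set E} {f : E → ℝ} (hf : ConvexOn ℝ W f) {w w' : E} (hw : w ∈ W)
    (hw' : w' ∈ W) (hd : DifferentiableAt ℝ f w) :
    f w + ⟪gradient f w, w' - w⟫ ≤ f w' := by
  have hg := hf.comp_affineMap (AffineMap.lineMap w w')
  have h0 : (0 : ℝ) ∈ (AffineMap.lineMap w w' : ℝ →ᵃ[ℝ] E) ⁻¹' W := by simpa using hw
  have h1 : (1 : ℝ) ∈ (AffineMap.lineMap w w' : ℝ →ᵃ[ℝ] E) ⁻¹' W := by simpa using hw'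
  have hl : HasDerivAt (AffineMap.lineMap w w' : ℝ → E) (w' - w) 0 := AffineMap.hasDerivAt_lineMap
  have hfd : HasFDerivAt f (InnerProductSpace.toDual ℝ E (gradient f w))
      ((AffineMap.lineMap w w' : ℝ → E) 0) := by
    simpa using hd.hasFDerivAt
  have hcomp := hfd.comp_hasDerivAt (0 : ℝ) hl
  have h := hg.le_slope_of_hasDerivAt h0 h1 one_pos hcomp
  simp only [InnerProductSpace.toDual_apply_apply, slope_def_field, Function.comp_apply,
    AffineMap.lineMap_apply_one, AffineMap.lineMap_apply_zero, sub_zero, div_one] at h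
  linarith

/-! ### Scalar estimates -/

section Scalar

variable {a C l l' lam0 : ℝ}

theorem exp_div_le (ha0 : 0 ≤ a) (haC : a ≤ C) (h0 : 0 < lam0) (hl : lam0 ≤ l) :
    Real.exp (a / l) ≤ Real.exp (C / lam0) := by
  have : 0 ≤ C := ha0.trans haC
  gcongr

theorem abs_image_sub_le_of_deriv_bound {f f' : ℝ → ℝ} {s : Set ℝ} {K x y : ℝ} (hs : Convex ℝ s)
    (hf : ∀ z ∈ s, HasDerivAt f (f' z) z) (hb : ∀ z ∈ s, |f' z| ≤ K) (hx : x ∈ s) (hy : y ∈ s) :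
    |f x - f y| ≤ K * |x - y| :=
  hs.norm_image_sub_le_of_norm_hasDerivWithin_le (fun z hz => (hf z hz).hasDerivWithinAt) hb hy hx

theorem hasDerivAt_exp_div (a : ℝ) (hl : l ≠ 0) :
    HasDerivAt (fun t => Real.exp (a / t)) (-(a / l ^ 2) * Real.exp (a / l)) l := by
  refine ((hasDerivAt_const l a).div (hasDerivAt_id' l) hl).exp.congr_deriv ?_
  change Real.exp (a / l) * ((0 * l - a * 1) / l ^ 2) = _
  ring

/-- This bound and the ones that follow are one-variable mean value estimates, in λ at a fixed loss
value or in the loss value at fixed λ. Lipschitz bounds for `g_i` and its partial derivatives arise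
by changing one of the two at a time. -/
theorem abs_exp_div_sub_le (ha0 : 0 ≤ a) (haC : a ≤ C) (h0 : 0 < lam0) (hl : lam0 ≤ l)
    (hl' : lam0 ≤ l') :
    |Real.exp (a / l) - Real.exp (a / l')| ≤ Real.exp (C / lam0) * (C / lam0 ^ 2) * |l - l'| := by
  refine abs_image_sub_le_of_deriv_bound (convex_Ici lam0)
    (fun z hz => hasDerivAt_exp_div a (h0.trans_le hz).ne') ?_ hl hl'
  intro z hz
  have hz' : lam0 ≤ z := hz
  have hC : 0 ≤ C := ha0.trans haC
  have hz0 := h0.trans_le hz'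
  rw [abs_mul, abs_neg, Real.abs_exp, abs_of_nonneg (by positivity), mul_comm]
  have := exp_div_le ha0 haC h0 hz'
  gcongr

theorem abs_exp_div_div_sub_le (ha0 : 0 ≤ a) (haC : a ≤ C) (h0 : 0 < lam0) (hl : lam0 ≤ l)
    (hl' : lam0 ≤ l') :
    |Real.exp (a / l) / l - Real.exp (a / l') / l'|
      ≤ Real.exp (C / lam0) * (C / lam0 ^ 3 + 1 / lam0 ^ 2) * |l - l'| := by
  refine abs_image_sub_le_of_deriv_bound (convex_Ici lam0) (f := fun t => Real.exp (a / t) / t)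
    (f' := fun z => -(Real.exp (a / z) * (a / z ^ 3 + 1 / z ^ 2))) ?_ ?_ hl hl'
  · intro z hz
    have hz0 : z ≠ 0 := (h0.trans_le hz).ne'
    refine ((hasDerivAt_exp_div a hz0).div (hasDerivAt_id' z) hz0).congr_deriv ?_
    field_simp
    ring
  · intro z hz
    have hz' : lam0 ≤ z := hz
    have hC : 0 ≤ C := ha0.trans haC
    have hz0 := h0.trans_le hz'
    rw [abs_neg, abs_of_nonneg (by positivity)]
    have := exp_div_le ha0 haC h0 hz'
    gcongr

theorem abs_mul_exp_div_sub_le (ha0 : 0 ≤ a) (haC : a ≤ C) (h0 : 0 < lam0) (hl : lam0 ≤ l)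
    (hl' : lam0 ≤ l') :
    |a / l ^ 2 * Real.exp (a / l) - a / l' ^ 2 * Real.exp (a / l')|
      ≤ Real.exp (C / lam0) * ((C ^ 2 + 2 * lam0 * C) / lam0 ^ 4) * |l - l'| := by
  refine abs_image_sub_le_of_deriv_bound (convex_Ici lam0)
    (f := fun t => a / t ^ 2 * Real.exp (a / t))
    (f' := fun z => -(Real.exp (a / z) * (a ^ 2 / z ^ 4 + 2 * (a / z ^ 3)))) ?_ ?_ hl hl'
  · intro z hz
    have hz0 : z ≠ 0 := (h0.trans_le hz).ne'
    refine (((hasDerivAt_const z a).div (hasDerivAt_pow 2 z) (pow_ne_zero 2 hz0)).mul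
      (hasDerivAt_exp_div a hz0)).congr_deriv ?_
    change (0 * z ^ 2 - a * ((2 : ℕ) * z ^ (2 - 1))) / (z ^ 2) ^ 2 * Real.exp (a / z)
      + a / z ^ 2 * (-(a / z ^ 2) * Real.exp (a / z)) = _
    push_cast
    field_simp
    ring
  · intro z hz
    have hz' : lam0 ≤ z := hz
    have hC : 0 ≤ C := ha0.trans haC
    have hz0 := h0.trans_le hz'
    rw [abs_neg, abs_of_nonneg (by positivity)]
    have := exp_div_le ha0 haC h0 hz'
    have h1 : (C ^ 2 + 2 * lam0 * C) / lam0 ^ 4 = C ^ 2 / lam0 ^ 4 + 2 * (C / lam0 ^ 3) := by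
      field_simp
    rw [h1]
    gcongr

variable {b : ℝ}

theorem abs_exp_div_sub_le_left (ha0 : 0 ≤ a) (haC : a ≤ C) (hb0 : 0 ≤ b) (hbC : b ≤ C)
    (h0 : 0 < lam0) (hl : lam0 ≤ l) :
    |Real.exp (a / l) - Real.exp (b / l)| ≤ Real.exp (C / lam0) / lam0 * |a - b| := by
  have hl0 := h0.trans_le hl
  refine abs_image_sub_le_of_deriv_bound (convex_Icc 0 C) (f := fun t => Real.exp (t / l))
    (f' := fun t => Real.exp (t / l) / l) ?_ ?_ ⟨ha0, haC⟩ ⟨hb0, hbC⟩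
  · intro z _
    refine ((hasDerivAt_id' z).div_const l).exp.congr_deriv ?_
    ring
  · intro z hz
    rw [abs_of_nonneg (by positivity)]
    have := exp_div_le hz.1 hz.2 h0 hl
    gcongr

theorem abs_mul_exp_div_sub_le_left (ha0 : 0 ≤ a) (haC : a ≤ C) (hb0 : 0 ≤ b) (hbC : b ≤ C)
    (h0 : 0 < lam0) (hl : lam0 ≤ l) :
    |a / l ^ 2 * Real.exp (a / l) - b / l ^ 2 * Real.exp (b / l)|
      ≤ Real.exp (C / lam0) * (1 / lam0 ^ 2 + C / lam0 ^ 3) * |a - b| := by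
  have hl0 := h0.trans_le hl
  refine abs_image_sub_le_of_deriv_bound (convex_Icc 0 C)
    (f := fun t => t / l ^ 2 * Real.exp (t / l))
    (f' := fun t => Real.exp (t / l) * (1 / l ^ 2 + t / l ^ 3)) ?_ ?_ ⟨ha0, haC⟩ ⟨hb0, hbC⟩
  · intro z _
    refine (((hasDerivAt_id' z).div_const (l ^ 2)).mul
      ((hasDerivAt_id' z).div_const l).exp).congr_deriv ?_
    field_simp
  · intro z hz
    have hz1 := hz.1
    have hz2 := hz.2
    have hC : 0 ≤ C := hz1.trans hz2
    rw [abs_of_nonneg (by positivity)]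
    have := exp_div_le hz.1 hz.2 h0 hl
    gcongr

end Scalar

/-! ### Regularity of a single loss -/

/-- A loss that is convex on `W`, with the bounds of `LossAssumption`. -/
structure IsRegularLoss {d : ℕ} (p : Params) (W : Set (Weights d)) (f : Weights d → ℝ) : Prop where
  convexOn : ConvexOn ℝ W f
  differentiable : ∀ w ∈ W, DifferentiableAt ℝ f w
  grad_le : ∀ w ∈ W, ‖gradient f w‖ ≤ p.G
  nonneg : ∀ w ∈ W, 0 ≤ f w
  le : ∀ w ∈ W, f w ≤ p.C
  smooth : ∀ w₁ ∈ W, ∀ w₂ ∈ W, ‖gradient f w₁ - gradient f w₂‖ ≤ p.L * ‖w₁ - w₂‖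

section Loss

variable {d : ℕ} {p : Params} {W : Set (Weights d)} {f : Weights d → ℝ} {x y : Point d}

theorem giW_eq (hd : DifferentiableAt ℝ f x.fst) :
    giW f x = (Real.exp (f x.fst / x.snd) / x.snd) • gradient f x.fst := by
  refine HasGradientAt.gradient ?_
  rw [hasGradientAt_iff_hasFDerivAt]
  refine (hd.hasGradientAt.hasFDerivAt.mul_const x.snd⁻¹).exp.congr_fderiv ?_
  rw [map_smul, smul_smul]
  rfl

theorem giLam_eq (hx : x.snd ≠ 0) :
    giLam f x = -(f x.fst / x.snd ^ 2 * Real.exp (f x.fst / x.snd)) := by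
  rw [← neg_mul]
  exact (hasDerivAt_exp_div (f x.fst) hx).deriv

theorem snd_pos (hp : p.Valid) (hx : x ∈ domain p W) : 0 < x.snd := hp.lam0_pos.trans_le hx.2.1

namespace IsRegularLoss

variable (hf : IsRegularLoss p W f)
include hf

/-- The tangent inequality at each of the two points, with the gradient bound there, gives the two
signs. -/
theorem abs_loss_sub_le {w w' : Weights d} (hw : w ∈ W) (hw' : w' ∈ W) :
    |f w - f w'| ≤ p.G * ‖w - w'‖ := by
  have key : ∀ {w w'}, w ∈ W → w' ∈ W → f w - f w' ≤ p.G * ‖w - w'‖ := by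
    intro w w' hw hw'
    have h := ConvexOn.add_inner_gradient_le hf.convexOn hw hw' (hf.differentiable w hw)
    have h1 := abs_real_inner_le_norm (gradient f w) (w' - w)
    have h2 : ‖gradient f w‖ * ‖w' - w‖ ≤ p.G * ‖w' - w‖ := by
      gcongr
      exact hf.grad_le w hw
    rw [norm_sub_rev w w']
    linarith [neg_abs_le ⟪gradient f w, w' - w⟫]
  rw [abs_le]
  constructor
  · have := key hw' hw
    rw [norm_sub_rev] at this
    linarith
  · exact key hw hw'

end IsRegularLoss

end Loss

/-! ### Elementary properties of the constants -/

theorem Params.LDg_nonneg (p : Params) : 0 ≤ p.LDg := Real.sqrt_nonneg _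

namespace Params.Valid

variable {p : Params} (hp : p.Valid)
include hp

theorem lamMax_pos : 0 < p.lamMax := by
  have h1 := hp.lam0_pos
  have h2 := hp.rho_pos
  have h3 := hp.C_nonneg
  unfold Params.lamMax
  positivity

theorem lam0_le_lamMax : p.lam0 ≤ p.lamMax := by
  have h2 := hp.rho_pos
  have h3 := hp.C_nonneg
  exact le_add_of_nonneg_right (by positivity)

theorem Lg_nonneg : 0 ≤ p.Lg := by
  have h1 := hp.lam0_pos
  have h2 := hp.G_nonneg
  have h3 := hp.C_nonneg
  unfold Params.Lg
  positivity

theorem one_le_LF : 1 ≤ p.LF := by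
  have h1 := hp.lamMax_pos
  have h2 := hp.Lg_nonneg
  have h3 := p.LDg_nonneg
  unfold Params.LF
  have : 0 ≤ p.lamMax * p.Lg ^ 2 + 2 * p.Lg + p.lamMax * p.LDg + p.lamMax := by positivity
  linarith

theorem LF_pos : 0 < p.LF := one_pos.trans_le hp.one_le_LF

theorem c_pos : 0 < p.c := by
  have := hp.LF_pos
  unfold Params.c
  positivity

theorem sigma_pos : 0 < p.sigma := lt_max_of_lt_left hp.sigmaG_pos

end Params.Valid

/-! ### Bounds and Lipschitz constants of a single `g_i` and its gradient -/

namespace IsRegularLoss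

variable {d : ℕ} {p : Params} {W : Set (Weights d)} {f : Weights d → ℝ} {x y : Point d}
variable (hp : p.Valid) (hf : IsRegularLoss p W f)
include hp hf

theorem one_le_gi (hx : x ∈ domain p W) : 1 ≤ gi f x :=
  Real.one_le_exp (div_nonneg (hf.nonneg _ hx.1) (snd_pos hp hx).le)

theorem gi_le (hx : x ∈ domain p W) : gi f x ≤ Real.exp (p.C / p.lam0) :=
  exp_div_le (hf.nonneg _ hx.1) (hf.le _ hx.1) hp.lam0_pos hx.2.1

theorem norm_giW_le (hx : x ∈ domain p W) :
    ‖giW f x‖ ≤ Real.exp (p.C / p.lam0) * (p.G / p.lam0) := by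
  have h0 := hp.lam0_pos
  have hs := snd_pos hp hx
  have hl := hx.2.1
  have h1 := hf.grad_le _ hx.1
  have h2 : Real.exp (f x.fst / x.snd) ≤ _ := hf.gi_le hp hx
  rw [giW_eq (hf.differentiable _ hx.1), norm_smul, Real.norm_of_nonneg (by positivity)]
  calc _ ≤ Real.exp (p.C / p.lam0) / p.lam0 * p.G := by gcongr
    _ = _ := by ring

theorem abs_giLam_le (hx : x ∈ domain p W) :
    |giLam f x| ≤ Real.exp (p.C / p.lam0) * (p.C / p.lam0 ^ 2) := by
  have h0 := hp.lam0_pos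
  have hC := hp.C_nonneg
  have hs := snd_pos hp hx
  have hl := hx.2.1
  have h1 := hf.nonneg _ hx.1
  have h3 := hf.le _ hx.1
  have h2 : Real.exp (f x.fst / x.snd) ≤ _ := hf.gi_le hp hx
  rw [giLam_eq hs.ne', abs_neg, abs_of_nonneg (by positivity), mul_comm]
  gcongr

theorem norm_giGrad_le (hx : x ∈ domain p W) : ‖giGrad f x‖ ≤ p.Lg := by
  refine (norm_mkPoint_le _ _).trans ?_
  rw [Params.Lg, mul_add]
  exact add_le_add (hf.norm_giW_le hp hx) (hf.abs_giLam_le hp hx)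

theorem abs_gi_sub_le (hx : x ∈ domain p W) (hy : y ∈ domain p W) :
    |gi f x - gi f y| ≤ p.Lg * ‖x - y‖ := by
  have h0 := hp.lam0_pos
  have hC := hp.C_nonneg
  have hG := hp.G_nonneg
  have h1 := abs_exp_div_sub_le_left (hf.nonneg _ hx.1) (hf.le _ hx.1) (hf.nonneg _ hy.1)
    (hf.le _ hy.1) h0 hx.2.1
  have h2 := abs_exp_div_sub_le (hf.nonneg _ hy.1) (hf.le _ hy.1) h0 hx.2.1 hy.2.1
  have h3 := hf.abs_loss_sub_le hx.1 hy.1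
  have h4 : ‖x.fst - y.fst‖ ≤ ‖x - y‖ := norm_fst_le (x - y)
  have h5 : |x.snd - y.snd| ≤ ‖x - y‖ := abs_snd_le (x - y)
  calc |gi f x - gi f y| ≤ |Real.exp (f x.fst / x.snd) - Real.exp (f y.fst / x.snd)|
        + |Real.exp (f y.fst / x.snd) - Real.exp (f y.fst / y.snd)| := abs_sub_le _ _ _
    _ ≤ Real.exp (p.C / p.lam0) / p.lam0 * (p.G * ‖x - y‖)
        + Real.exp (p.C / p.lam0) * (p.C / p.lam0 ^ 2) * ‖x - y‖ := by
      refine add_le_add (h1.trans ?_) (h2.trans ?_)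
      · gcongr
        exact h3.trans (by gcongr)
      · gcongr
    _ = _ := by rw [Params.Lg]; ring

theorem norm_giW_sub_le (hx : x ∈ domain p W) (hy : y ∈ domain p W) :
    ‖giW f x - giW f y‖ ≤ p.LA * ‖x.fst - y.fst‖ + p.LB * |x.snd - y.snd| := by
  have h0 := hp.lam0_pos
  have hC := hp.C_nonneg
  have hG := hp.G_nonneg
  have hL := hp.L_nonneg
  have hs := snd_pos hp hx
  have hxl := hx.2.1
  have h1 := abs_exp_div_sub_le_left (hf.nonneg _ hx.1) (hf.le _ hx.1) (hf.nonneg _ hy.1)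
    (hf.le _ hy.1) h0 hxl
  have h2 := abs_exp_div_div_sub_le (hf.nonneg _ hy.1) (hf.le _ hy.1) h0 hxl hy.2.1
  have h3 := hf.abs_loss_sub_le hx.1 hy.1
  have h4 := hf.smooth _ hx.1 _ hy.1
  have h5 := hf.grad_le _ hy.1
  have h6 : Real.exp (f x.fst / x.snd) ≤ _ := hf.gi_le hp hx
  rw [giW_eq (hf.differentiable _ hx.1), giW_eq (hf.differentiable _ hy.1)]
  -- One ingredient changes at a time: the gradient of the loss, then the loss value, then λ.
  have hsplit : (Real.exp (f x.fst / x.snd) / x.snd) • gradient f x.fst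
      - (Real.exp (f y.fst / y.snd) / y.snd) • gradient f y.fst
      = (Real.exp (f x.fst / x.snd) / x.snd) • (gradient f x.fst - gradient f y.fst)
        + ((Real.exp (f x.fst / x.snd) - Real.exp (f y.fst / x.snd)) / x.snd) • gradient f y.fst
        + (Real.exp (f y.fst / x.snd) / x.snd - Real.exp (f y.fst / y.snd) / y.snd)
          • gradient f y.fst := by
    module
  rw [hsplit]
  refine (norm_add₃_le).trans ?_
  simp only [norm_smul, Real.norm_eq_abs, abs_div, Real.abs_exp, abs_of_pos hs]
  calc _ ≤ Real.exp (p.C / p.lam0) / p.lam0 * (p.L * ‖x.fst - y.fst‖)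
        + (Real.exp (p.C / p.lam0) / p.lam0 * (p.G * ‖x.fst - y.fst‖)) / p.lam0 * p.G
        + Real.exp (p.C / p.lam0) * (p.C / p.lam0 ^ 3 + 1 / p.lam0 ^ 2) *
          |x.snd - y.snd| * p.G := by
        gcongr
        exact h1.trans (by gcongr)
    _ = _ := by rw [Params.LA, Params.LB]; ring

theorem abs_giLam_sub_le (hx : x ∈ domain p W) (hy : y ∈ domain p W) :
    |giLam f x - giLam f y| ≤ p.LC * ‖x.fst - y.fst‖ + p.LD * |x.snd - y.snd| := by
  have h0 := hp.lam0_pos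
  have hC := hp.C_nonneg
  have h1 := abs_mul_exp_div_sub_le_left (hf.nonneg _ hx.1) (hf.le _ hx.1) (hf.nonneg _ hy.1)
    (hf.le _ hy.1) h0 hx.2.1
  have h2 := abs_mul_exp_div_sub_le (hf.nonneg _ hy.1) (hf.le _ hy.1) h0 hx.2.1 hy.2.1
  have h3 := hf.abs_loss_sub_le hx.1 hy.1
  rw [giLam_eq (snd_pos hp hx).ne', giLam_eq (snd_pos hp hy).ne', neg_sub_neg, abs_sub_comm]
  refine (abs_sub_le _ (f y.fst / x.snd ^ 2 * Real.exp (f y.fst / x.snd)) _).trans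
    (add_le_add (h1.trans ?_) h2)
  calc _ ≤ Real.exp (p.C / p.lam0) * (1 / p.lam0 ^ 2 + p.C / p.lam0 ^ 3)
        * (p.G * ‖x.fst - y.fst‖) := by gcongr
    _ = _ := by
      rw [Params.LC]
      field_simp
      ring

/-- The increments of the two components are bounded by the matrix with rows (L_A, L_B) and (L_C,
L_D) applied to (‖Δw‖, |Δλ|). Its Frobenius norm is L_{∇g}, and Cauchy–Schwarz concludes. -/
theorem norm_giGrad_sub_le (hx : x ∈ domain p W) (hy : y ∈ domain p W) :
    ‖giGrad f x - giGrad f y‖ ≤ p.LDg * ‖x - y‖ := by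
  refine (sq_le_sq₀ (norm_nonneg _) (mul_nonneg p.LDg_nonneg (norm_nonneg _))).1 ?_
  rw [giGrad, giGrad, mkPoint_sub, norm_mkPoint_sq, mul_pow, Params.LDg,
    Real.sq_sqrt (by positivity), norm_point_sq]
  have h1 := pow_le_pow_left₀ (norm_nonneg _) (hf.norm_giW_sub_le hp hx hy) 2
  have h2 := pow_le_pow_left₀ (abs_nonneg _) (hf.abs_giLam_sub_le hp hx hy) 2
  change _ ≤ _ * (‖x.fst - y.fst‖ ^ 2 + |x.snd - y.snd| ^ 2)
  nlinarith [sq_nonneg (p.LA * |x.snd - y.snd| - p.LB * ‖x.fst - y.fst‖),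
    sq_nonneg (p.LC * |x.snd - y.snd| - p.LD * ‖x.fst - y.fst‖)]

end IsRegularLoss

theorem LossAssumption.isRegularLoss {d n : ℕ} {p : Params} {R : ℝ} {W : Set (Weights d)}
    {loss : Fin n → Weights d → ℝ} (h : LossAssumption p R W loss)
    (hconv : ∀ i, ConvexOn ℝ W (loss i)) (i : Fin n) : IsRegularLoss p W (loss i) :=
  ⟨hconv i, h.differentiable i, h.grad_le i, h.loss_nonneg i, h.loss_le i, h.smooth i⟩

/-! ### The objective on the feasible set -/

theorem convex_domain {d : ℕ} (p : Params) {W : Set (Weights d)} (hW : Convex ℝ W) :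
    Convex ℝ (domain p W) := by
  intro x hx y hy a b ha hb hab
  exact ⟨hW hx.1 hy.1 ha hb hab, convex_Icc _ _ hx.2 hy.2 ha hb hab⟩

theorem isCompact_domain {d : ℕ} (p : Params) {W : Set (Weights d)} (hW : IsCompact W) :
    IsCompact (domain p W) := by
  have h := (hW.prod (isCompact_Icc (a := p.lam0) (b := p.lamMax))).image
    (WithLp.prod_continuous_toLp 2 (Weights d) ℝ)
  convert h using 1
  ext x
  constructor
  · intro hx
    exact ⟨(x.fst, x.snd), hx, rfl⟩
  · rintro ⟨y, hy, rfl⟩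
    exact hy

section Objective

variable {d n : ℕ}

theorem g_eq_mean (loss : Fin n → Weights d → ℝ) (x : Point d) :
    g loss x = mean fun i => gi (loss i) x := by
  simp [g, mean]

theorem gGrad_eq_mean (loss : Fin n → Weights d → ℝ) (x : Point d) :
    gGrad loss x = mean fun i => giGrad (loss i) x := by
  simp [gGrad, mean]

/-- The gradient of `F`. -/
noncomputable def gradF (p : Params) (loss : Fin n → Weights d → ℝ) (x : Point d) : Point d :=
  (x.snd / g loss x) • gGrad loss x + mkPoint 0 (Real.log (g loss x) + p.rho)

/-- The gradient of `F_μ`. -/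
noncomputable def gradFmu (p : Params) (loss : Fin n → Weights d → ℝ) (mu : ℝ) (x : Point d) :
    Point d :=
  gradF p loss x + mu • x

theorem direction_eq (p : Params) (mu : ℝ) (S : State d) :
    direction p mu S = (S.x.snd / max S.s 1) • mkPoint S.v S.u
      + mkPoint 0 (Real.log (max S.s 1) + p.rho) + mu • S.x := by
  rw [direction, smul_mkPoint, mkPoint_add, add_zero, add_assoc]

variable [NeZero n] {p : Params} {W : Set (Weights d)} {loss : Fin n → Weights d → ℝ}
  {x y : Point d} {mu : ℝ}
variable (hp : p.Valid) (hf : ∀ i, IsRegularLoss p W (loss i))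
include hp hf

theorem one_le_g (hx : x ∈ domain p W) : 1 ≤ g loss x := by
  rw [g_eq_mean]
  exact le_mean_of_forall_le fun i => (hf i).one_le_gi hp hx

theorem norm_gGrad_le (hx : x ∈ domain p W) : ‖gGrad loss x‖ ≤ p.Lg := by
  rw [gGrad_eq_mean]
  exact (norm_mean_le _).trans (mean_le_of_forall_le fun i => (hf i).norm_giGrad_le hp hx)

theorem abs_g_sub_le (hx : x ∈ domain p W) (hy : y ∈ domain p W) :
    |g loss x - g loss y| ≤ p.Lg * ‖x - y‖ := by
  rw [g_eq_mean, g_eq_mean, ← mean_sub]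
  refine (norm_mean_le fun i => gi (loss i) x - gi (loss i) y).trans (mean_le_of_forall_le ?_)
  exact fun i => (hf i).abs_gi_sub_le hp hx hy

theorem norm_gGrad_sub_le (hx : x ∈ domain p W) (hy : y ∈ domain p W) :
    ‖gGrad loss x - gGrad loss y‖ ≤ p.LDg * ‖x - y‖ := by
  rw [gGrad_eq_mean, gGrad_eq_mean, ← mean_sub]
  exact (norm_mean_le _).trans (mean_le_of_forall_le fun i => (hf i).norm_giGrad_sub_le hp hx hy)

/-- The first-order characterization of the convexity of `F`. -/
theorem F_add_inner_gradF_le (hx : x ∈ domain p W) (hy : y ∈ domain p W) :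
    F p loss x + ⟪gradF p loss x, y - x⟫ ≤ F p loss y := by
  have hsx := snd_pos hp hx
  have hsy := snd_pos hp hy
  have hgx := one_le_g hp hf hx
  have hgy := one_le_g hp hf hy
  have hgx0 : 0 < g loss x := by linarith
  have hgy0 : 0 < g loss y := by linarith
  -- The proof is Jensen's inequality with weights g_i(x)/g(x), in the form a ≤ m - 1 + exp(a - m).
  -- This `m` makes the averaged right side (m - 1)g(x) + exp(-m)g(y) equal to m g(x).
  set m := Real.log (g loss y) - Real.log (g loss x) with hm
  have hexp : Real.exp (-m) = g loss x / g loss y := by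
    rw [hm, neg_sub, Real.exp_sub, Real.exp_log hgx0, Real.exp_log hgy0]
  have hpt : ∀ i, ⟪giGrad (loss i) x, y - x⟫
      ≤ y.snd / x.snd * ((m - 1) * gi (loss i) x + Real.exp (-m) * gi (loss i) y) := by
    intro i
    have hconv := ConvexOn.add_inner_gradient_le (hf i).convexOn hx.1 hy.1
      ((hf i).differentiable _ hx.1)
    set a := loss i y.fst / y.snd - loss i x.fst / x.snd with ha
    have h1 : gi (loss i) y = gi (loss i) x * Real.exp a := by
      rw [gi, gi, ← Real.exp_add, ha]
      congr 1
      ring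
    have h2 := Real.add_one_le_exp (a - m)
    have h3 : Real.exp (a - m) = Real.exp a * Real.exp (-m) := by
      rw [← Real.exp_add, sub_eq_add_neg]
    have hgi : 0 < gi (loss i) x := Real.exp_pos _
    rw [inner_point]
    change ⟪giW (loss i) x, y.fst - x.fst⟫ + giLam (loss i) x * (y.snd - x.snd) ≤ _
    rw [giW_eq ((hf i).differentiable _ hx.1), giLam_eq hsx.ne', real_inner_smul_left]
    change gi (loss i) x / x.snd * _ + -(_ * gi (loss i) x) * _ ≤ _
    -- After convexity of the loss is used, the terms in ℓ_i(x) combine with the λ-derivative to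
    -- leave exactly λ_y/λ_x times g_i(x) times the increment `a` of ℓ_i/λ. This is the perspective
    -- structure.
    calc _ ≤ gi (loss i) x / x.snd * (loss i y.fst - loss i x.fst)
          + -(loss i x.fst / x.snd ^ 2 * gi (loss i) x) * (y.snd - x.snd) := by
          gcongr
          linarith
      _ = y.snd / x.snd * (gi (loss i) x * a) := by
          rw [ha]
          field_simp
          ring
      _ ≤ _ := by
          rw [h1]
          have : gi (loss i) x * a ≤ gi (loss i) x * (m - 1 + Real.exp (a - m)) := by
            gcongr
            linarith
          rw [h3] at this
          gcongr
          linarith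
  have hmean := mean_mono hpt
  rw [mean_mul_left, mean_add, mean_mul_left, mean_mul_left, ← g_eq_mean, ← g_eq_mean] at hmean
  have hin : ⟪gGrad loss x, y - x⟫ = mean fun i => ⟪giGrad (loss i) x, y - x⟫ := by
    rw [gGrad_eq_mean, real_inner_comm]
    refine (map_mean (innerₗ _ (y - x)) _).trans ?_
    simp only [innerₗ_apply_apply, real_inner_comm]
  have hb : x.snd / g loss x * ⟪gGrad loss x, y - x⟫ ≤ y.snd * m := by
    rw [hin]
    calc _ ≤ x.snd / g loss x * (y.snd / x.snd * ((m - 1) * g loss x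
          + Real.exp (-m) * g loss y)) := by gcongr
      _ = y.snd * m := by
          rw [hexp]
          field_simp
          ring
  have hinner : ⟪gradF p loss x, y - x⟫ = x.snd / g loss x * ⟪gGrad loss x, y - x⟫
      + (Real.log (g loss x) + p.rho) * (y.snd - x.snd) := by
    rw [gradF, inner_add_left, real_inner_smul_left, inner_point (mkPoint _ _)]
    simp
  rw [hinner, F, F]
  rw [hm] at hb
  nlinarith

/-- The first-order characterization of the strong convexity of `F_μ`. -/
theorem Fmu_add_inner_gradFmu_le (hx : x ∈ domain p W) (hy : y ∈ domain p W) :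
    Fmu p loss mu x + ⟪gradFmu p loss mu x, y - x⟫ + mu / 2 * ‖y - x‖ ^ 2 ≤ Fmu p loss mu y := by
  have h := F_add_inner_gradF_le hp hf hx hy
  have h2 : ‖y‖ ^ 2 = ‖x‖ ^ 2 + 2 * ⟪x, y - x⟫ + ‖y - x‖ ^ 2 := by
    rw [← norm_add_sq_real, add_sub_cancel]
  rw [Fmu, Fmu, gradFmu, inner_add_left, real_inner_smul_left, h2]
  linarith

omit hp hf [NeZero n] in
theorem abs_log_sub_log_le {a b : ℝ} (ha : 1 ≤ a) (hb : 1 ≤ b) :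
    |Real.log a - Real.log b| ≤ |a - b| := by
  have key : ∀ {a b : ℝ}, 1 ≤ a → 1 ≤ b → Real.log a - Real.log b ≤ |a - b| := by
    intro a b ha hb
    have ha0 : 0 < a := by linarith
    have hb0 : 0 < b := by linarith
    rw [← Real.log_div ha0.ne' hb0.ne']
    calc Real.log (a / b) ≤ a / b - 1 := Real.log_le_sub_one_of_pos (by positivity)
      _ = (a - b) / b := by field_simp
      _ ≤ |a - b| / b := by gcongr; exact le_abs_self _
      _ ≤ |a - b| := div_le_self (abs_nonneg _) hb
  rw [abs_le]
  have h := key hb ha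
  rw [abs_sub_comm] at h
  exact ⟨by linarith, key ha hb⟩

-- Used both for the Lipschitz bound on `gradFmu` and for the error of `direction`. The splitting
-- lets `A` occur only in `A - B`, because the running estimate of ∇g need not be bounded by L_g.
omit hf [NeZero n] in
theorem norm_smul_div_sub_le {H : Type*} [SeminormedAddCommGroup H] [NormedSpace ℝ H] {r r' a b : ℝ}
    {A B : H} (ha : 1 ≤ a) (hb : 1 ≤ b) (hr : |r| ≤ p.lamMax) (hr' : |r'| ≤ p.lamMax)
    (hB : ‖B‖ ≤ p.Lg) :
    ‖(r / a) • A - (r' / b) • B‖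
      ≤ p.lamMax * ‖A - B‖ + |r - r'| * p.Lg + p.lamMax * |a - b| * p.Lg := by
  have ha0 : 0 < a := by linarith
  have hb0 : 0 < b := by linarith
  have hM := hp.lamMax_pos
  have hsplit : (r / a) • A - (r' / b) • B
      = (r / a) • (A - B) + ((r - r') / a) • B + (r' * (b - a) / (a * b)) • B := by
    have : r' * (b - a) / (a * b) = r' / a - r' / b := by field_simp
    rw [this]
    module
  rw [hsplit]
  refine norm_add₃_le.trans ?_
  simp only [norm_smul, Real.norm_eq_abs, abs_div, abs_mul, abs_of_pos ha0, abs_of_pos hb0]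
  have h1 : |r| / a ≤ p.lamMax := (div_le_self (abs_nonneg _) ha).trans hr
  have h2 : |r - r'| / a ≤ |r - r'| := div_le_self (abs_nonneg _) ha
  have h3 : |r'| * |b - a| / (a * b) ≤ p.lamMax * |a - b| := by
    rw [abs_sub_comm b a]
    refine (div_le_self (by positivity) (one_le_mul_of_one_le_of_one_le ha hb)).trans ?_
    gcongr
  gcongr

omit hf [NeZero n] in
theorem abs_snd_le_lamMax (hx : x ∈ domain p W) : |x.snd| ≤ p.lamMax := by
  rw [abs_of_pos (snd_pos hp hx)]
  exact hx.2.2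

omit hp hf [NeZero n] in
theorem norm_mkPoint_zero (l : ℝ) : ‖(mkPoint 0 l : Point d)‖ ≤ |l| := by
  simpa using norm_mkPoint_le (0 : Weights d) l

theorem norm_gradFmu_sub_le (hmu0 : 0 ≤ mu) (hmu1 : mu ≤ 1) (hx : x ∈ domain p W)
    (hy : y ∈ domain p W) :
    ‖gradFmu p loss mu x - gradFmu p loss mu y‖ ≤ p.LF * ‖x - y‖ := by
  have hgx := one_le_g hp hf hx
  have hgy := one_le_g hp hf hy
  have hM := hp.lamMax_pos
  have hLg := hp.Lg_nonneg
  have h1 := norm_smul_div_sub_le hp (A := gGrad loss x) hgx hgy (abs_snd_le_lamMax hp hx)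
    (abs_snd_le_lamMax hp hy) (norm_gGrad_le hp hf hy)
  have h2 := norm_gGrad_sub_le hp hf hx hy
  have h3 := abs_g_sub_le hp hf hx hy
  have h4 : |x.snd - y.snd| ≤ ‖x - y‖ := abs_snd_le (x - y)
  have h5 := (norm_mkPoint_zero (d := d) (Real.log (g loss x) - Real.log (g loss y))).trans
    (abs_log_sub_log_le hgx hgy)
  have hsplit : gradFmu p loss mu x - gradFmu p loss mu y
      = ((x.snd / g loss x) • gGrad loss x - (y.snd / g loss y) • gGrad loss y)
        + mkPoint 0 (Real.log (g loss x) - Real.log (g loss y)) + mu • (x - y) := by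
    have : (mkPoint 0 (Real.log (g loss x) - Real.log (g loss y)) : Point d)
        = mkPoint 0 (Real.log (g loss x) + p.rho) - mkPoint 0 (Real.log (g loss y) + p.rho) := by
      rw [mkPoint_sub, sub_zero]
      congr 1
      ring
    rw [this, gradFmu, gradFmu, gradF, gradF]
    module
  rw [hsplit]
  refine norm_add₃_le.trans ?_
  rw [norm_smul, Real.norm_of_nonneg hmu0]
  calc _ ≤ (p.lamMax * (p.LDg * ‖x - y‖) + ‖x - y‖ * p.Lg
          + p.lamMax * (p.Lg * ‖x - y‖) * p.Lg) + p.Lg * ‖x - y‖ + 1 * ‖x - y‖ := by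
        refine add_le_add (add_le_add (h1.trans ?_) (h5.trans h3)) (by gcongr)
        gcongr
    _ = (p.LF - p.lamMax) * ‖x - y‖ := by rw [Params.LF]; ring
    _ ≤ p.LF * ‖x - y‖ := by gcongr; linarith

/-- Convexity at `y` bounds F_μ(y) - F_μ(x) by ⟨∇F_μ(y), y - x⟩, and replacing ∇F_μ(y) by ∇F_μ(x)
costs L_F‖y - x‖². The constant is twice the usual L_F/2, but F is never differentiated along the
segment. -/
theorem Fmu_le_add_inner_gradFmu (hmu0 : 0 ≤ mu) (hmu1 : mu ≤ 1) (hx : x ∈ domain p W)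
    (hy : y ∈ domain p W) :
    Fmu p loss mu y ≤ Fmu p loss mu x + ⟪gradFmu p loss mu x, y - x⟫ + p.LF * ‖y - x‖ ^ 2 := by
  have h1 := Fmu_add_inner_gradFmu_le (mu := mu) hp hf hy hx
  have h2 := norm_gradFmu_sub_le hp hf hmu0 hmu1 hy hx
  have h3 := real_inner_le_norm (gradFmu p loss mu y - gradFmu p loss mu x) (y - x)
  rw [inner_sub_left] at h3
  have h4 : ‖gradFmu p loss mu y - gradFmu p loss mu x‖ * ‖y - x‖ ≤ p.LF * ‖y - x‖ ^ 2 := by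
    rw [sq, ← mul_assoc]
    gcongr
  rw [← neg_sub y x, inner_neg_right, norm_neg] at h1
  nlinarith [sq_nonneg ‖y - x‖]

theorem continuousOn_Fmu : ContinuousOn (Fmu p loss mu) (domain p W) := by
  have hfst : Continuous fun x : Point d => x.fst := WithLp.continuous_fst 2 _ _
  have hsnd : Continuous fun x : Point d => x.snd := WithLp.continuous_snd 2 _ _
  have hgi : ∀ i, ContinuousOn (gi (loss i)) (domain p W) := by
    intro i x hx
    have h1 : ContinuousAt (fun x : Point d => loss i x.fst) x :=
      ContinuousAt.comp (f := fun x : Point d => x.fst)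
        ((hf i).differentiable _ hx.1).continuousAt hfst.continuousAt
    exact (h1.div hsnd.continuousAt (snd_pos hp hx).ne').rexp.continuousWithinAt
  have hg : ContinuousOn (g loss) (domain p W) :=
    continuousOn_const.mul (continuousOn_finsetSum _ fun i _ => hgi i)
  have hlog : ContinuousOn (fun x => Real.log (g loss x)) (domain p W) :=
    hg.log fun x hx => (one_pos.trans_le (one_le_g hp hf hx)).ne'
  have hF : ContinuousOn (F p loss) (domain p W) :=
    (hsnd.continuousOn.mul hlog).add (hsnd.continuousOn.mul continuousOn_const)
  exact hF.add (by fun_prop)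

theorem exists_gap_eq (hW : IsCompact W) (hne : (domain p W).Nonempty) :
    ∃ y ∈ domain p W, ∀ x, gap p W loss mu x = Fmu p loss mu x - Fmu p loss mu y := by
  obtain ⟨y, hy, hmin⟩ := (isCompact_domain p hW).exists_isMinOn hne
    (continuousOn_Fmu (mu := mu) hp hf)
  refine ⟨y, hy, fun x => ?_⟩
  have : IsLeast (Fmu p loss mu '' domain p W) (Fmu p loss mu y) := by
    refine ⟨⟨y, hy, rfl⟩, ?_⟩
    rintro _ ⟨z, hz, rfl⟩
    exact hmin hz
  rw [gap, this.csInf_eq]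

end Objective

/-! ### Inexact projected gradient steps -/

section Step

variable {H : Type*} [NormedAddCommGroup H] [InnerProductSpace ℝ H]

/-- `f` is `μ`-strongly convex on `X`, and satisfies a quadratic upper bound, in first-order form
with respect to the field `grad`. -/
structure IsStronglyConvexSmooth (X : Set H) (f : H → ℝ) (grad : H → H) (mu M : ℝ) : Prop where
  convex : Convex ℝ X
  lower : ∀ x ∈ X, ∀ y ∈ X, f x + ⟪grad x, y - x⟫ + mu / 2 * ‖y - x‖ ^ 2 ≤ f y
  upper : ∀ x ∈ X, ∀ y ∈ X, f y ≤ f x + ⟪grad x, y - x⟫ + M * ‖y - x‖ ^ 2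

namespace IsStronglyConvexSmooth

variable {X : Set H} {f : H → ℝ} {grad : H → H} {mu M : ℝ} {x x' y z : H} {eta P : ℝ}
variable (hf : IsStronglyConvexSmooth X f grad mu M)
include hf

/-- The field `grad` is not assumed to be a derivative. The optimality condition follows from the
quadratic upper bound at y + t(x - y), divided by t, as t → 0+. -/
theorem inner_grad_minimizer_nonneg (hy : y ∈ X) (hmin : ∀ x ∈ X, f y ≤ f x) (hx : x ∈ X) :
    0 ≤ ⟪grad y, x - y⟫ := by
  have hlim : Filter.Tendsto (fun t : ℝ => ⟪grad y, x - y⟫ + M * ‖x - y‖ ^ 2 * t)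
      (nhdsWithin 0 (Set.Ioi 0)) (nhds (⟪grad y, x - y⟫ + M * ‖x - y‖ ^ 2 * 0)) :=
    tendsto_nhdsWithin_of_tendsto_nhds (Continuous.tendsto (by fun_prop) 0)
  rw [mul_zero, add_zero] at hlim
  refine ge_of_tendsto hlim ?_
  filter_upwards [Ioc_mem_nhdsGT (one_pos : (0 : ℝ) < 1)] with t ht
  have hz : y + t • (x - y) ∈ X := hf.convex.add_smul_sub_mem hy hx ⟨ht.1.le, ht.2⟩
  have h1 := hf.upper y hy _ hz
  have h2 := hmin _ hz
  rw [add_sub_cancel_left, inner_smul_right, norm_smul, Real.norm_of_nonneg ht.1.le, mul_pow] at h1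
  have h3 : 0 ≤ t * (⟪grad y, x - y⟫ + M * ‖x - y‖ ^ 2 * t) := by linarith
  exact nonneg_of_mul_nonneg_right h3 ht.1

theorem half_mul_norm_sub_minimizer_sq_le (hy : y ∈ X) (hmin : ∀ x ∈ X, f y ≤ f x) (hx : x ∈ X) :
    mu / 2 * ‖x - y‖ ^ 2 ≤ f x - f y := by
  have h1 := hf.lower y hy x hx
  have h2 := hf.inner_grad_minimizer_nonneg hy hmin hx
  linarith

/-- Descent along a projected step in an inexact gradient direction `z`. -/
theorem norm_step_sq_le (hx : x ∈ X) (hx' : x' ∈ X)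
    (hproj : ∀ w ∈ X, ⟪x - eta • z - x', w - x'⟫ ≤ 0) (heta : 0 < eta) (hM : eta * M ≤ 1 / 4)
    (hP : ‖z - grad x‖ ^ 2 ≤ 2 * P) :
    ‖x' - x‖ ^ 2 ≤ 4 * eta * (f x - f x') + 4 * eta ^ 2 * P := by
  have h1 := hproj x hx
  have h2 : ‖x' - x‖ ^ 2 + eta * ⟪z, x' - x⟫ ≤ 0 := by
    have : x - eta • z - x' = -(x' - x) - eta • z := by abel
    rw [this, ← neg_sub x' x, inner_neg_right, inner_sub_left, inner_neg_left,
      real_inner_smul_left, real_inner_self_eq_norm_sq] at h1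
    linarith
  have h3 := hf.upper x hx x' hx'
  have h4 : ⟪grad x, x' - x⟫ = ⟪z, x' - x⟫ - ⟪z - grad x, x' - x⟫ := by
    rw [inner_sub_left]; ring
  have h5 := neg_le_of_abs_le (abs_real_inner_le_norm (z - grad x) (x' - x))
  -- Young's inequality spends half of ‖x' - x‖² here and smoothness spends a quarter in `h7`. The
  -- remaining quarter explains the factors 4 in the conclusion.
  have h6 : eta * (‖z - grad x‖ * ‖x' - x‖) ≤ eta ^ 2 * P + ‖x' - x‖ ^ 2 / 2 := by
    nlinarith [sq_nonneg (eta * ‖z - grad x‖ - ‖x' - x‖), sq_nonneg eta]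
  have h7 : eta * M * ‖x' - x‖ ^ 2 ≤ 1 / 4 * ‖x' - x‖ ^ 2 := by gcongr
  have h8 : eta * f x' ≤ eta * (f x + (⟪z, x' - x⟫ + ‖z - grad x‖ * ‖x' - x‖)
      + M * ‖x' - x‖ ^ 2) := by
    gcongr
    linarith
  linarith

/-- Progress of a projected step in an inexact gradient direction `z` towards the minimizer. -/
theorem step_gap_le (hmu : 0 < mu) (hx : x ∈ X) (hx' : x' ∈ X)
    (hproj : ∀ w ∈ X, ⟪x - eta • z - x', w - x'⟫ ≤ 0) (heta : 0 < eta) (hM : eta * M ≤ 1 / 4)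
    (hP : ‖z - grad x‖ ^ 2 ≤ 2 * P) (hy : y ∈ X) (hmin : ∀ x ∈ X, f y ≤ f x) :
    eta * (f x' - f y) ≤ ‖x - y‖ ^ 2 - ‖x' - y‖ ^ 2 + 4 * eta / mu * P := by
  have h1 := hproj y hy
  have h2 : eta * ⟪z, x' - y⟫
      ≤ (‖x - y‖ ^ 2 - ‖x' - y‖ ^ 2 - ‖x' - x‖ ^ 2) / 2 := by
    have e1 : x - eta • z - x' = -(x' - x) - eta • z := by abel
    have e2 : x - y = (x' - y) - (x' - x) := by abel
    rw [e2, norm_sub_sq_real]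
    rw [e1, ← neg_sub x' y, inner_neg_right, inner_sub_left, inner_neg_left,
      real_inner_smul_left, real_inner_comm] at h1
    linarith
  have h3 := hf.upper x hx x' hx'
  have h4 := hf.lower x hx y hy
  have h5 : ⟪grad x, x' - x⟫ - ⟪grad x, y - x⟫ = ⟪z, x' - y⟫ - ⟪z - grad x, x' - y⟫ := by
    rw [← inner_sub_right, sub_sub_sub_cancel_right, inner_sub_left]
    ring
  have h6 := neg_le_of_abs_le (abs_real_inner_le_norm (z - grad x) (x' - y))
  have h7 := hf.half_mul_norm_sub_minimizer_sq_le hy hmin hx'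
  -- Young's inequality with weight μ/4: by the quadratic growth `h7`, the term in ‖x' - y‖² is at
  -- most half of the gap at x' and can be moved to the left side.
  have h8 : ‖z - grad x‖ * ‖x' - y‖ ≤ 2 / mu * P + mu / 4 * ‖x' - y‖ ^ 2 := by
    have : 2 * (‖z - grad x‖ * ‖x' - y‖) ≤ 2 / mu * ‖z - grad x‖ ^ 2 + mu / 2 * ‖x' - y‖ ^ 2 := by
      have e : 2 / mu * ‖z - grad x‖ ^ 2 + mu / 2 * ‖x' - y‖ ^ 2
          - 2 * (‖z - grad x‖ * ‖x' - y‖)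
          = (2 * ‖z - grad x‖ - mu * ‖x' - y‖) ^ 2 / (2 * mu) := by
        field_simp
        ring
      have : 0 ≤ (2 * ‖z - grad x‖ - mu * ‖x' - y‖) ^ 2 / (2 * mu) := by positivity
      linarith
    have h : 2 / mu * ‖z - grad x‖ ^ 2 ≤ 2 / mu * (2 * P) := by gcongr
    linarith
  have h9 : 0 ≤ mu / 2 * ‖y - x‖ ^ 2 := by positivity
  have h10 : f x' - f y ≤ ⟪z, x' - y⟫ + (2 / mu * P + (f x' - f y) / 2) + M * ‖x' - x‖ ^ 2 := by
    linarith
  have h11 := mul_le_mul_of_nonneg_left h10 heta.le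
  have h12 : eta * M * ‖x' - x‖ ^ 2 ≤ 1 / 4 * ‖x' - x‖ ^ 2 := by gcongr
  have h13 : 4 * eta / mu * P = 2 * (eta * (2 / mu * P)) := by ring
  rw [h13]
  nlinarith [sq_nonneg ‖x' - x‖]

end IsStronglyConvexSmooth

end Step

/-! ### The projection -/

section Proj

variable {d : ℕ} {X : Set (Point d)}

theorem proj_spec (hX : IsCompact X) (hne : X.Nonempty) (y : Point d) :
    proj X y ∈ X ∧ ∀ z' ∈ X, ‖y - proj X y‖ ≤ ‖y - z'‖ := by
  obtain ⟨z, hz, hmin⟩ := hX.exists_isMinOn hne (f := fun z => ‖y - z‖) (by fun_prop)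
  exact Classical.epsilon_spec (p := fun z => z ∈ X ∧ ∀ z' ∈ X, ‖y - z‖ ≤ ‖y - z'‖)
    ⟨z, hz, fun z' hz' => hmin hz'⟩

theorem inner_sub_proj_le_zero (hX : IsCompact X) (hc : Convex ℝ X) (hne : X.Nonempty)
    (y : Point d) : ∀ w ∈ X, ⟪y - proj X y, w - proj X y⟫ ≤ 0 := by
  obtain ⟨h1, h2⟩ := proj_spec hX hne y
  refine (norm_eq_iInf_iff_real_inner_le_zero hc h1).1 ?_
  have : Nonempty X := hne.to_subtype
  refine le_antisymm (le_ciInf fun z => h2 z z.2) ?_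
  exact ciInf_le ⟨0, by rintro _ ⟨z, rfl⟩; exact norm_nonneg _⟩ (⟨_, h1⟩ : X)

end Proj

/-! ### The estimators -/

/-- The weight of the error of the estimator of `g` in the analysis. -/
noncomputable def Params.kappa (p : Params) : ℝ := p.lamMax * p.Lg + 1

/-- A pair of estimates of `∇ g` and `g`, rescaled to compensate their influence on `direction`. -/
noncomputable def weighted {d : ℕ} (p : Params) : Point d × ℝ →ₗ[ℝ] WithLp 2 (Point d × ℝ) :=
  (WithLp.linearEquiv 2 ℝ (Point d × ℝ)).symm.toLinearMap ∘ₗ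
    (p.lamMax • LinearMap.id).prodMap (p.kappa • LinearMap.id)

/-- The estimates of `∇ g` and `g` carried by a state. -/
noncomputable def estimate {d : ℕ} (S : State d) : Point d × ℝ := (mkPoint S.v S.u, S.s)

/-- The gradient and the value of `g_i`. -/
noncomputable def sample {d : ℕ} (f : Weights d → ℝ) (x : Point d) : Point d × ℝ :=
  (giGrad f x, gi f x)

/-- The weighted squared error of the estimators. -/
noncomputable def err {d n : ℕ} (p : Params) (loss : Fin n → Weights d → ℝ) (S : State d) : ℝ :=
  ‖weighted p (estimate S) - mean fun i => weighted p (sample (loss i) S.x)‖ ^ 2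

section Estimators

variable {d n : ℕ} {p : Params}

theorem norm_weighted_sq (a : Point d × ℝ) :
    ‖weighted p a‖ ^ 2 = p.lamMax ^ 2 * ‖a.1‖ ^ 2 + p.kappa ^ 2 * a.2 ^ 2 := by
  rw [WithLp.prod_norm_sq_eq_of_L2]
  change ‖p.lamMax • a.1‖ ^ 2 + ‖p.kappa * a.2‖ ^ 2 = _
  rw [norm_smul, Real.norm_eq_abs, Real.norm_eq_abs, mul_pow, sq_abs, sq_abs, mul_pow]

theorem mean_weighted_sample (loss : Fin n → Weights d → ℝ) (x : Point d) :
    mean (fun i => weighted p (sample (loss i) x)) = weighted p (gGrad loss x, g loss x) := by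
  rw [← map_mean, gGrad_eq_mean, g_eq_mean]
  congr 1
  ext1 <;> simp [mean, sample, Prod.fst_sum, Prod.snd_sum]

theorem err_eq (loss : Fin n → Weights d → ℝ) (S : State d) :
    err p loss S = p.lamMax ^ 2 * ‖mkPoint S.v S.u - gGrad loss S.x‖ ^ 2
      + p.kappa ^ 2 * (S.s - g loss S.x) ^ 2 := by
  rw [err, mean_weighted_sample, ← map_sub, norm_weighted_sq]
  rfl

theorem estimate_step (W : Set (Weights d)) (mu eta beta : ℝ) (S : State d) (f : Weights d → ℝ) :
    estimate (step p W mu eta beta S f) = sample f (step p W mu eta beta S f).x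
      + (1 - beta) • (estimate S - sample f S.x) := rfl

/-- Turns the two variance bounds into L_F²σ² for the weighted pair. It uses the summand λ̃ of L_F,
which the Lipschitz bound on `gradFmu` leaves unspent. -/
theorem sq_add_kappa_sq_le_LF_sq (hp : p.Valid) : p.lamMax ^ 2 + p.kappa ^ 2 ≤ p.LF ^ 2 := by
  have h1 := hp.lamMax_pos
  have h2 := hp.Lg_nonneg
  have h3 := p.LDg_nonneg
  have h : p.lamMax * p.Lg ^ 2 + 2 * p.Lg + 1 + p.lamMax ≤ p.LF := by
    have : 0 ≤ p.lamMax * p.LDg := by positivity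
    rw [Params.LF]
    linarith
  refine le_trans ?_ (pow_le_pow_left₀ (by positivity) h 2)
  rw [Params.kappa, ← sub_nonneg]
  ring_nf
  positivity

theorem norm_weighted_sample_sub_le (hp : p.Valid) {W : Set (Weights d)} {f : Weights d → ℝ}
    (hf : IsRegularLoss p W f) {x y : Point d} (hx : x ∈ domain p W) (hy : y ∈ domain p W) :
    ‖weighted p (sample f x) - weighted p (sample f y)‖ ≤ p.LF * ‖x - y‖ := by
  have h1 := hp.lamMax_pos
  have h2 := hp.Lg_nonneg
  have h3 := p.LDg_nonneg
  have h4 := hp.LF_pos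
  refine (sq_le_sq₀ (norm_nonneg _) (by positivity)).1 ?_
  rw [← map_sub, norm_weighted_sq]
  change _ * ‖giGrad f x - giGrad f y‖ ^ 2 + _ * (gi f x - gi f y) ^ 2 ≤ _
  have h5 := hf.norm_giGrad_sub_le hp hx hy
  have h6 := hf.abs_gi_sub_le hp hx hy
  rw [← sq_abs (gi f x - gi f y)]
  calc _ ≤ p.lamMax ^ 2 * (p.LDg * ‖x - y‖) ^ 2 + p.kappa ^ 2 * (p.Lg * ‖x - y‖) ^ 2 := by gcongr
    _ = ((p.lamMax * p.LDg) ^ 2 + (p.kappa * p.Lg) ^ 2) * ‖x - y‖ ^ 2 := by ring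
    _ ≤ (p.lamMax * p.LDg + p.kappa * p.Lg) ^ 2 * ‖x - y‖ ^ 2 := by
        have : 0 ≤ p.lamMax * p.LDg * (p.kappa * p.Lg) := by unfold Params.kappa; positivity
        gcongr
        nlinarith
    _ ≤ (p.LF * ‖x - y‖) ^ 2 := by
        rw [mul_pow]
        have : 0 ≤ p.lamMax * p.LDg + p.kappa * p.Lg := by unfold Params.kappa; positivity
        gcongr
        unfold Params.kappa Params.LF
        nlinarith

theorem mean_norm_weighted_sample_sub_sq_le (hp : p.Valid) {W : Set (Weights d)}
    {loss : Fin n → Weights d → ℝ} (hv : VarianceAssumption p W loss) {x : Point d}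
    (hx : x ∈ domain p W) :
    mean (fun i => ‖weighted p (sample (loss i) x) - mean fun i => weighted p (sample (loss i) x)‖
      ^ 2) ≤ p.LF ^ 2 * p.sigma ^ 2 := by
  have h1 : mean (fun i => (gi (loss i) x - g loss x) ^ 2) ≤ p.sigma ^ 2 := by
    have h := hv.value x hx
    simp only [mean, Fintype.card_fin, smul_eq_mul]
    refine h.trans (pow_le_pow_left₀ hp.sigmaG_pos.le (le_max_left _ _) 2)
  have h2 : mean (fun i => ‖giGrad (loss i) x - gGrad loss x‖ ^ 2) ≤ p.sigma ^ 2 := by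
    have h := hv.grad x hx
    simp only [mean, Fintype.card_fin, smul_eq_mul]
    refine h.trans (pow_le_pow_left₀ hp.sigmaDG_pos.le (le_max_right _ _) 2)
  simp only [mean_weighted_sample, ← map_sub, norm_weighted_sq, mean_add, mean_mul_left]
  calc _ ≤ p.lamMax ^ 2 * p.sigma ^ 2 + p.kappa ^ 2 * p.sigma ^ 2 := by
        gcongr
        · exact h2
        · exact h1
    _ = (p.lamMax ^ 2 + p.kappa ^ 2) * p.sigma ^ 2 := by ring
    _ ≤ _ := by
        gcongr
        exact sq_add_kappa_sq_le_LF_sq hp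

variable [NeZero n]

/-- An a priori bound for the variance of the samples. -/
theorem mean_norm_weighted_sample_sub_sq_le_LF_pow (hp : p.Valid) {W : Set (Weights d)}
    {loss : Fin n → Weights d → ℝ} (hf : ∀ i, IsRegularLoss p W (loss i)) {x : Point d}
    (hx : x ∈ domain p W) :
    mean (fun i => ‖weighted p (sample (loss i) x) - mean fun i => weighted p (sample (loss i) x)‖
      ^ 2) ≤ p.LF ^ 4 := by
  have hM := hp.lamMax_pos
  have hLg := hp.Lg_nonneg
  have hLF := hp.one_le_LF
  have h0 := hp.lam0_pos
  have hC := hp.C_nonneg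
  have hG := hp.G_nonneg
  -- From e^s - 1 ≤ s e^s at s = C/λ₀.
  have hE : Real.exp (p.C / p.lam0) - 1 ≤ p.lamMax * p.Lg := by
    have h1 := Real.add_one_le_exp (-(p.C / p.lam0))
    have h2 : Real.exp (p.C / p.lam0) * Real.exp (-(p.C / p.lam0)) = 1 := by
      rw [← Real.exp_add, add_neg_cancel, Real.exp_zero]
    have h3 : Real.exp (p.C / p.lam0) - 1 ≤ Real.exp (p.C / p.lam0) * (p.C / p.lam0) := by
      nlinarith [Real.exp_pos (p.C / p.lam0)]
    calc _ ≤ _ := h3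
      _ = p.lam0 * (Real.exp (p.C / p.lam0) * (p.C / p.lam0 ^ 2)) := by field_simp
      _ ≤ p.lamMax * p.Lg := by
        have : 0 ≤ p.G / p.lam0 := by positivity
        have := hp.lam0_le_lamMax
        unfold Params.Lg
        gcongr
        linarith
  -- Subtracting the constant pair (0, 1) leaves the variance unchanged, and 0 ≤ g_i - 1 ≤ λ̃L_g by
  -- `hE`. The resulting bound is free of σ, as the initial batch size is.
  have hshift := mean_norm_sub_mean_sq_le fun i => weighted p (sample (loss i) x - (0, 1))
  have heq : ∀ i, weighted p (sample (loss i) x - (0, 1))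
      - mean (fun i => weighted p (sample (loss i) x - (0, 1)))
      = weighted p (sample (loss i) x) - mean fun i => weighted p (sample (loss i) x) := by
    intro i
    simp only [map_sub, mean_sub, mean_const]
    abel
  simp only [heq] at hshift
  refine hshift.trans (mean_le_of_forall_le fun i => ?_)
  rw [norm_weighted_sq]
  change _ * ‖giGrad (loss i) x - 0‖ ^ 2 + _ * (gi (loss i) x - 1) ^ 2 ≤ _
  rw [sub_zero]
  have h1 := (hf i).norm_giGrad_le hp hx
  have h2 : gi (loss i) x - 1 ≤ p.lamMax * p.Lg := by linarith [(hf i).gi_le hp hx]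
  have h3 : 0 ≤ gi (loss i) x - 1 := by linarith [(hf i).one_le_gi hp hx]
  -- By 2L_g ≤ L_g² + 1, multiplied by λ̃.
  have h4 : 2 * (p.lamMax * p.Lg) ≤ p.LF := by
    have : 0 ≤ p.lamMax * p.LDg := mul_nonneg hM.le p.LDg_nonneg
    unfold Params.LF
    nlinarith [mul_nonneg hM.le (sq_nonneg (p.Lg - 1))]
  set a := p.lamMax * p.Lg with ha
  have ha0 : 0 ≤ a := by positivity
  calc _ ≤ p.lamMax ^ 2 * p.Lg ^ 2 + p.kappa ^ 2 * a ^ 2 := by gcongr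
    _ = a ^ 2 + (a + 1) ^ 2 * a ^ 2 := by rw [Params.kappa, ha]; ring
    _ ≤ (p.LF / 2) ^ 2 + (p.LF / 2 + p.LF) ^ 2 * (p.LF / 2) ^ 2 := by
        gcongr <;> linarith
    _ = p.LF ^ 2 / 4 + 9 / 16 * p.LF ^ 4 := by ring
    _ ≤ p.LF ^ 4 := by nlinarith [sq_nonneg (p.LF ^ 2), one_le_pow₀ hLF (n := 2)]

/-- Since g ≥ 1, replacing s by max s 1 brings it no further from g, and on [1, ∞) both log s and
1/s are 1-Lipschitz. The weights λ̃ and κ are the coefficients of the two errors in the resulting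
linear bound, and (a + b)² ≤ 2(a² + b²) gives the factor 2. -/
theorem norm_direction_sub_gradFmu_sq_le (hp : p.Valid) {W : Set (Weights d)}
    {loss : Fin n → Weights d → ℝ} (hf : ∀ i, IsRegularLoss p W (loss i)) {mu : ℝ} {S : State d}
    (hx : S.x ∈ domain p W) :
    ‖direction p mu S - gradFmu p loss mu S.x‖ ^ 2 ≤ 2 * err p loss S := by
  have hg := one_le_g hp hf hx
  have hM := hp.lamMax_pos
  have hLg := hp.Lg_nonneg
  have hs : 1 ≤ max S.s 1 := le_max_right _ _
  have h1 := norm_smul_div_sub_le hp (A := mkPoint S.v S.u) hs hg (abs_snd_le_lamMax hp hx)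
    (abs_snd_le_lamMax hp hx) (norm_gGrad_le hp hf hx)
  rw [sub_self, abs_zero, zero_mul, add_zero] at h1
  have h2 : |max S.s 1 - g loss S.x| ≤ |S.s - g loss S.x| := by
    have := abs_max_sub_max_le_abs S.s (g loss S.x) 1
    rwa [max_eq_left hg] at this
  have h3 := (norm_mkPoint_zero (d := d) (Real.log (max S.s 1) - Real.log (g loss S.x))).trans
    (abs_log_sub_log_le hs hg)
  have hsplit : direction p mu S - gradFmu p loss mu S.x
      = ((S.x.snd / max S.s 1) • mkPoint S.v S.u - (S.x.snd / g loss S.x) • gGrad loss S.x)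
        + mkPoint 0 (Real.log (max S.s 1) - Real.log (g loss S.x)) := by
    have : (mkPoint 0 (Real.log (max S.s 1) - Real.log (g loss S.x)) : Point d)
        = mkPoint 0 (Real.log (max S.s 1) + p.rho)
          - mkPoint 0 (Real.log (g loss S.x) + p.rho) := by
      rw [mkPoint_sub, sub_zero]
      congr 1
      ring
    rw [this, direction_eq, gradFmu, gradF]
    abel
  have h4 : ‖direction p mu S - gradFmu p loss mu S.x‖
      ≤ p.lamMax * ‖mkPoint S.v S.u - gGrad loss S.x‖ + p.kappa * |S.s - g loss S.x| := by
    rw [hsplit]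
    refine (norm_add_le _ _).trans ((add_le_add h1 h3).trans ?_)
    calc _ ≤ p.lamMax * ‖mkPoint S.v S.u - gGrad loss S.x‖ + p.lamMax * |S.s - g loss S.x| * p.Lg
          + |S.s - g loss S.x| := by gcongr
      _ = _ := by rw [Params.kappa]; ring
  refine (pow_le_pow_left₀ (norm_nonneg _) h4 2).trans ?_
  rw [err_eq, ← sq_abs (S.s - g loss S.x)]
  nlinarith [sq_nonneg (p.lamMax * ‖mkPoint S.v S.u - gGrad loss S.x‖
    - p.kappa * |S.s - g loss S.x|)]

end Estimators

/-! ### Summation of the one-step estimates -/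

section Sums

variable {P D a r : ℕ → ℝ} {T : ℕ} {beta eta mu M V : ℝ}

/-- Accumulated estimator errors over one run. -/
theorem sum_error_le (hM : 16 * M ^ 2 * eta ^ 2 ≤ beta)
    (heta : 0 < eta) (hP0 : ∀ t, 0 ≤ P t) (ha0 : ∀ t, 0 ≤ a t)
    (hP : ∀ t < T, P (t + 1) ≤ (1 - beta) * P t + 2 * M ^ 2 * D t + 2 * beta ^ 2 * V)
    (hD : ∀ t < T, D t ≤ 4 * eta * (a t - a (t + 1)) + 4 * eta ^ 2 * P t) :
    beta * ∑ t ∈ Finset.range T, P t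
      ≤ 2 * P 0 + 16 * M ^ 2 * eta * a 0 + 4 * beta ^ 2 * V * T := by
  have h1 : ∑ t ∈ Finset.range T, D t ≤ 4 * eta * a 0 + 4 * eta ^ 2 * ∑ t ∈ Finset.range T, P t := by
    have h := Finset.sum_le_sum fun t ht => hD t (Finset.mem_range.1 ht)
    rw [Finset.sum_add_distrib, ← Finset.mul_sum, ← Finset.mul_sum, Finset.sum_range_sub'] at h
    have : 0 ≤ 4 * eta * a T := mul_nonneg (by positivity) (ha0 T)
    linarith
  have h2 : beta * ∑ t ∈ Finset.range T, P t
      ≤ P 0 + 2 * M ^ 2 * ∑ t ∈ Finset.range T, D t + 2 * beta ^ 2 * V * T := by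
    have h : ∑ t ∈ Finset.range T, beta * P t
        ≤ ∑ t ∈ Finset.range T, ((P t - P (t + 1)) + 2 * M ^ 2 * D t + 2 * beta ^ 2 * V) :=
      Finset.sum_le_sum fun t ht => by linarith [hP t (Finset.mem_range.1 ht)]
    rw [Finset.sum_add_distrib, Finset.sum_add_distrib, ← Finset.mul_sum, ← Finset.mul_sum,
      Finset.sum_range_sub', Finset.sum_const, Finset.card_range, nsmul_eq_mul] at h
    linarith [hP0 T]
  have h3 : 2 * M ^ 2 * ∑ t ∈ Finset.range T, D t
      ≤ 2 * M ^ 2 * (4 * eta * a 0 + 4 * eta ^ 2 * ∑ t ∈ Finset.range T, P t) := by gcongr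
  -- The errors feed back through the step lengths with weight 8M²η², at most half of β. Absorbing
  -- this half doubles the other terms.
  have h4 : 16 * M ^ 2 * eta ^ 2 * ∑ t ∈ Finset.range T, P t
      ≤ beta * ∑ t ∈ Finset.range T, P t :=
    mul_le_mul_of_nonneg_right hM (Finset.sum_nonneg fun t _ => hP0 t)
  linarith

/-- Accumulated optimality gaps over one run. -/
theorem sum_gap_le (heta : 0 < eta) (ha0 : ∀ t, 0 ≤ a t) (hr0 : ∀ t, 0 ≤ r t)
    (hr : r 0 ≤ 2 / mu * a 0)
    (ha : ∀ t < T, eta * a (t + 1) ≤ r t - r (t + 1) + 4 * eta / mu * P t) :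
    eta * ∑ t ∈ Finset.range T, a t
      ≤ eta * a 0 + 2 / mu * a 0 + 4 * eta / mu * ∑ t ∈ Finset.range T, P t := by
  have h := Finset.sum_le_sum fun t ht => ha t (Finset.mem_range.1 ht)
  rw [← Finset.mul_sum, Finset.sum_add_distrib, ← Finset.mul_sum, Finset.sum_range_sub'] at h
  -- The step estimates control a 1, …, a T, while the output is drawn from the indices 0, …, T - 1.
  -- The shift costs a 0.
  have h1 : ∑ t ∈ Finset.range T, a t ≤ a 0 + ∑ t ∈ Finset.range T, a (t + 1) := by
    have e1 := Finset.sum_range_succ a T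
    have e2 := Finset.sum_range_succ' a T
    linarith [ha0 T]
  have h2 := mul_le_mul_of_nonneg_left h1 heta.le
  linarith [hr0 T]

end Sums

/-! ### The parameters of a stage -/

/-- The relations between the parameters of a stage with target accuracy `eps` that are used in
the analysis. -/
structure StageParams (M s mu eps eta beta T : ℝ) : Prop where
  beta_pos : 0 < beta
  beta_le : beta ≤ 1
  eta_pos : 0 < eta
  eta_mul_le : eta * M ≤ 1 / 4
  eta_sq_le : 16 * M ^ 2 * eta ^ 2 ≤ beta
  le_beta_mul : 192 * M ^ 2 ≤ beta * T
  le_eta_mul : 8 ≤ eta * mu * T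
  beta_sigma_le : 768 * (beta * (M ^ 2 * s ^ 2)) ≤ mu * eps
  ratio_le : 192 * (16 * M ^ 2 * eta) ≤ mu * (beta * T)
  le_T : 100 ≤ T

theorem rpow_three_halves_mul_sqrt {mu eps : ℝ} (hmu : 0 < mu) :
    mu ^ (3 / 2 : ℝ) * Real.sqrt eps = mu * Real.sqrt (mu * eps) := by
  rw [show (3 / 2 : ℝ) = 1 + 1 / 2 by norm_num, Real.rpow_add hmu, Real.rpow_one,
    ← Real.sqrt_eq_rpow, Real.sqrt_mul hmu.le, mul_assoc]

theorem epsStage_pos {Δ : ℝ} (hΔ : 0 < Δ) (k : ℕ) : 0 < epsStage Δ k := by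
  unfold epsStage
  positivity

/-- With q = √(με), everything is polynomial in q once denominators are cleared. In the lower bounds
on η or β, the term attaining the minimum in η or β determines which of the three terms of T_k is
used: for example the q-term of η with the first gives ημT ≥ 192/24 = 8. -/
theorem stageParams {p : Params} (hp : p.Valid) {mu Δ : ℝ} (hmu0 : 0 < mu) (hmu : mu ≤ 1 / 2)
    (hΔ : 0 < Δ) (k : ℕ) :
    StageParams p.LF p.sigma mu (epsStage Δ k) (etaStage p mu Δ k) (betaStage p mu Δ k)
      (lenStage p mu Δ k) := by
  have heps := epsStage_pos hΔ k
  unfold etaStage betaStage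
  have hT : max (192 * p.c * p.LF * p.sigma / (mu ^ (3 / 2 : ℝ) * Real.sqrt (epsStage Δ k)))
      (max (192 * p.c * p.LF ^ 2 * p.sigma ^ 2 / (mu * epsStage Δ k))
      (192 * p.c * p.LF ^ 2 / mu)) ≤ (lenStage p mu Δ k : ℝ) := Nat.le_ceil _
  rw [rpow_three_halves_mul_sqrt hmu0] at hT
  generalize (lenStage p mu Δ k : ℝ) = T at hT
  generalize epsStage Δ k = eps at *
  have hL1 := hp.one_le_LF
  have hc : p.c = 768 * p.LF ^ 2 := rfl
  have hc0 := hp.c_pos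
  have hs := hp.sigma_pos
  have hms : 0 < mu * eps := by positivity
  have hq := Real.sq_sqrt hms.le
  have hq0 := Real.sqrt_pos.2 hms
  generalize Real.sqrt (mu * eps) = q at *
  rw [← hq] at hT ⊢
  generalize p.LF = M at *
  generalize p.c = c at *
  generalize p.sigma = s at *
  have hM0 : 0 < M := by linarith
  have hM2 : 1 ≤ M ^ 2 := one_le_pow₀ hL1
  have hc1 : 768 ≤ c := by rw [hc]; linarith
  obtain ⟨hT1, hT2, hT3⟩ : 192 * c * M * s ≤ T * (mu * q) ∧ 192 * c * M ^ 2 * s ^ 2 ≤ T * q ^ 2 ∧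
      192 * c * M ^ 2 ≤ T * mu := by
    rw [max_le_iff, max_le_iff, div_le_iff₀ (by positivity), div_le_iff₀ (by positivity),
      div_le_iff₀ hmu0] at hT
    exact hT
  have hT100 : 192 * 768 ≤ T * mu := by
    refine le_trans ?_ hT3
    nlinarith
  have hT0 : 0 < T := pos_of_mul_pos_left (lt_of_lt_of_le (by norm_num) hT100) hmu0.le
  set beta := min (q ^ 2 / (c * s ^ 2)) (1 / c) with hbeta
  set eta := min (q / (24 * c * M * s)) (1 / (24 * c * M ^ 2)) with heta
  have hbeta0 : 0 < beta := by rw [hbeta]; positivity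
  have heta0 : 0 < eta := by rw [heta]; positivity
  have hb1 : beta * (c * s ^ 2) ≤ q ^ 2 := by
    rw [← le_div_iff₀ (by positivity)]
    exact min_le_left _ _
  have hb2 : beta * c ≤ 1 := by
    rw [← le_div_iff₀ (by positivity)]
    exact min_le_right _ _
  have he1 : eta * (24 * c * M * s) ≤ q := by
    rw [← le_div_iff₀ (by positivity)]
    exact min_le_left _ _
  have he2 : eta * (24 * c * M ^ 2) ≤ 1 := by
    rw [← le_div_iff₀ (by positivity)]
    exact min_le_right _ _
  have hbcases : beta * (c * s ^ 2) = q ^ 2 ∨ beta * c = 1 := by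
    rcases min_choice (q ^ 2 / (c * s ^ 2)) (1 / c) with h | h
    · left; rw [hbeta, h]; field_simp
    · right; rw [hbeta, h]; field_simp
  have hecases : eta * (24 * c * M * s) = q ∨ eta * (24 * c * M ^ 2) = 1 := by
    rcases min_choice (q / (24 * c * M * s)) (1 / (24 * c * M ^ 2)) with h | h
    · left; rw [heta, h]; field_simp
    · right; rw [heta, h]; field_simp
  clear_value beta eta
  clear hbeta heta hT
  refine ⟨hbeta0, ?_, heta0, ?_, ?_, ?_, ?_, ?_, ?_, ?_⟩
  · nlinarith
  · have h1 : 0 ≤ eta * M := by positivity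
    have h2 : 1 ≤ c * M := by nlinarith
    have h3 : eta * M * 24 ≤ eta * M * 24 * (c * M) := le_mul_of_one_le_right (by positivity) h2
    nlinarith
  · rcases hbcases with h | h
    · have h1 : (eta * (24 * c * M * s)) ^ 2 ≤ beta * (c * s ^ 2) := by
        rw [h]
        gcongr
      have h2 : (c * s ^ 2) * (576 * c * (M ^ 2 * eta ^ 2)) ≤ (c * s ^ 2) * beta := by linarith
      have h3 := le_of_mul_le_mul_left h2 (by positivity)
      have h4 : 0 ≤ M ^ 2 * eta ^ 2 := by positivity
      nlinarith
    · have h1 : (eta * (24 * c * M ^ 2)) ^ 2 ≤ beta * c := by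
        rw [h]
        exact pow_le_one₀ (by positivity) he2
      have h2 : c * (576 * c * M ^ 2 * (M ^ 2 * eta ^ 2)) ≤ c * beta := by linarith
      have h3 := le_of_mul_le_mul_left h2 hc0
      have h4 : 0 ≤ M ^ 2 * eta ^ 2 := by positivity
      have h5 : 16 ≤ 576 * c * M ^ 2 := by nlinarith
      nlinarith
  · rcases hbcases with h | h
    · rw [← h] at hT2
      have h2 : (c * s ^ 2) * (192 * M ^ 2) ≤ (c * s ^ 2) * (beta * T) := by linarith
      exact le_of_mul_le_mul_left h2 (by positivity)
    · have h1 : beta * (192 * c * M ^ 2) ≤ beta * (T * mu) := by gcongr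
      have h2 : beta * (T * mu) ≤ beta * (T * 1) := by gcongr; linarith
      have h3 : beta * (192 * c * M ^ 2) = (beta * c) * (192 * M ^ 2) := by ring
      rw [h, one_mul] at h3
      linarith
  · rcases hecases with h | h
    · have h1 : 8 * q ≤ (eta * mu * T) * q := by
        have : eta * (192 * c * M * s) ≤ eta * (T * (mu * q)) := by gcongr
        linarith
      exact le_of_mul_le_mul_right h1 hq0
    · have : eta * (192 * c * M ^ 2) ≤ eta * (T * mu) := by gcongr
      linarith
  · rw [← hq]
    calc _ = beta * (768 * M ^ 2 * s ^ 2) := by ring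
      _ = beta * (c * s ^ 2) := by rw [hc]
      _ ≤ q ^ 2 := hb1
  · rcases hbcases with h | h
    · have h1 : beta * (192 * c * M * s) ≤ beta * (T * (mu * q)) := by gcongr
      have h2 : 192 * M * q ≤ mu * (beta * T) * s := by
        have : (192 * M * q) * q ≤ (mu * (beta * T) * s) * q := by
          calc (192 * M * q) * q = 192 * M * (beta * (c * s ^ 2)) := by rw [h]; ring
            _ = beta * (192 * c * M * s) * s := by ring
            _ ≤ beta * (T * (mu * q)) * s := by gcongr
            _ = _ := by ring
        exact le_of_mul_le_mul_right this hq0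
      have h3 : 192 * (16 * M ^ 2 * eta) * s ≤ 192 * M * q := by
        have h4 : 24 * (eta * M * s) ≤ c * 24 * (eta * M * s) := by
          have : 0 ≤ eta * M * s := by positivity
          nlinarith
        have h5 : 16 * (eta * M * s) ≤ q := by
          have : 0 ≤ eta * M * s := by positivity
          linarith
        calc _ = 192 * M * (16 * (eta * M * s)) := by ring
          _ ≤ _ := by gcongr
      exact le_of_mul_le_mul_right (h3.trans h2) hs
    · have h1 : beta * (192 * c * M ^ 2) ≤ beta * (T * mu) := by gcongr
      have h2 : beta * (192 * c * M ^ 2) = (beta * c) * (192 * M ^ 2) := by ring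
      rw [h, one_mul] at h2
      have h3 : eta * M ^ 2 * 24 ≤ eta * M ^ 2 * 24 * c :=
        le_mul_of_one_le_right (by positivity) (by linarith)
      nlinarith
  · nlinarith

/-! ### One run of ASCDRO -/

section Run

variable {d n T : ℕ} {p : Params} {W : Set (Weights d)} {loss : Fin n → Weights d → ℝ}
  {mu eta beta : ℝ} {S : State d} {ξ : Fin T → Fin n}

theorem path_succ {t : ℕ} (ht : t < T) :
    path p W loss mu eta beta S ξ (t + 1)
      = step p W mu eta beta (path p W loss mu eta beta S ξ t) (loss (ξ ⟨t, ht⟩)) := by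
  rw [path, dif_pos ht]

theorem path_update (a : Fin T) (i : Fin n) {t : ℕ} (ht : t ≤ a) :
    path p W loss mu eta beta S (Function.update ξ a i) t = path p W loss mu eta beta S ξ t := by
  induction t with
  | zero => rfl
  | succ t ih =>
    have htT : t < T := by omega
    have hne : (⟨t, htT⟩ : Fin T) ≠ a := by
      rintro rfl
      simp at ht
    rw [path_succ htT, path_succ htT, ih (by omega), Function.update_of_ne hne]

theorem path_mem_domain (hW : IsCompact (domain p W)) (hS : S.x ∈ domain p W) (t : ℕ) :
    (path p W loss mu eta beta S ξ t).x ∈ domain p W := by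
  induction t with
  | zero => exact hS
  | succ t ih =>
    rw [path]
    split_ifs with h
    · exact (proj_spec hW ⟨_, hS⟩ _).1
    · exact ih

/-- Averages over independent samples of a quantity that depends on the samples of the first
`t + 1` iterations. -/
theorem mean_path_succ [NeZero n] {t : ℕ} (ht : t < T) (φ : State d → ℝ) :
    mean (fun ξ : Fin T → Fin n => φ (path p W loss mu eta beta S ξ (t + 1)))
      = mean fun ξ : Fin T → Fin n => mean fun i =>
        φ (step p W mu eta beta (path p W loss mu eta beta S ξ t) (loss i)) := by
  simp only [path_succ ht]
  exact mean_resample (⟨t, ht⟩ : Fin T)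
    (fun ξ i => φ (step p W mu eta beta (path p W loss mu eta beta S ξ t) (loss i)))
    fun ξ i j => by rw [path_update _ _ le_rfl]

variable [NeZero n]

theorem ascdro_of_ne_zero (hT : T ≠ 0) : ascdro p W loss mu eta beta T S
    = (PMF.uniformOfFintype (Fin T → Fin n)).bind fun ξ =>
      haveI : NeZero T := ⟨hT⟩
      (PMF.uniformOfFintype (Fin T)).map fun τ : Fin T => path p W loss mu eta beta S ξ τ := by
  rw [ascdro, dif_neg hT]
  congr 1
  funext ξ
  -- In `ascdro` the uniform law on `Fin T` is coerced to a law on `ℕ`, which unfolds to a `bind`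
  -- with `pure`; mapping through it gives the plain form.
  exact (PMF.map_bind _ _ _).trans (congrArg _ (funext fun τ => PMF.pure_map _ _))

theorem support_ascdro_finite (hT : T ≠ 0) : (ascdro p W loss mu eta beta T S).support.Finite := by
  rw [ascdro_of_ne_zero hT, PMF.support_bind]
  have : NeZero T := ⟨hT⟩
  exact (Set.toFinite _).biUnion fun ξ _ => support_uniform_map_finite _

theorem mem_domain_of_mem_support_ascdro (hT : T ≠ 0) (hW : IsCompact (domain p W))
    (hS : S.x ∈ domain p W) {S' : State d} (h : S' ∈ (ascdro p W loss mu eta beta T S).support) :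
    S'.x ∈ domain p W := by
  have : NeZero T := ⟨hT⟩
  rw [ascdro_of_ne_zero hT, PMF.mem_support_bind_iff] at h
  obtain ⟨ξ, -, h⟩ := h
  rw [PMF.mem_support_map_iff] at h
  obtain ⟨τ, -, rfl⟩ := h
  exact path_mem_domain hW hS _

theorem expectation_ascdro (hT : T ≠ 0) (φ : State d → ℝ) :
    expectation (ascdro p W loss mu eta beta T S) φ
      = (T : ℝ)⁻¹ * ∑ t ∈ Finset.range T,
        mean fun ξ : Fin T → Fin n => φ (path p W loss mu eta beta S ξ t) := by
  have : NeZero T := ⟨hT⟩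
  rw [ascdro_of_ne_zero hT, expectation_bind (Set.toFinite _)
    fun ξ _ => support_uniform_map_finite _, expectation_uniform, ← mean_sum, ← mean_mul_left]
  congr 1
  funext ξ
  rw [expectation_uniform_map, mean, Fintype.card_fin, smul_eq_mul,
    Fin.sum_univ_eq_sum_range fun t => φ (path p W loss mu eta beta S ξ t)]

end Run

/-- The assumptions on an instance of the problem that are used in the analysis. -/
structure IsRegularInstance {d n : ℕ} (p : Params) (W : Set (Weights d))
    (loss : Fin n → Weights d → ℝ) : Prop where
  valid : p.Valid
  convex : Convex ℝ W
  isCompact : IsCompact W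
  regular : ∀ i, IsRegularLoss p W (loss i)
  variance : VarianceAssumption p W loss

section Stage

variable {d n : ℕ} [NeZero n] {p : Params} {W : Set (Weights d)} {loss : Fin n → Weights d → ℝ}
  {mu eps eta beta : ℝ} {T : ℕ} {S : State d}
variable (hI : IsRegularInstance p W loss)
include hI

theorem isStronglyConvexSmooth_Fmu (hmu0 : 0 ≤ mu) (hmu1 : mu ≤ 1) :
    IsStronglyConvexSmooth (domain p W) (Fmu p loss mu) (gradFmu p loss mu) mu p.LF where
  convex := convex_domain p hI.convex
  lower _ hx _ hy := Fmu_add_inner_gradFmu_le hI.valid hI.regular hx hy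
  upper _ hx _ hy := Fmu_le_add_inner_gradFmu hI.valid hI.regular hmu0 hmu1 hx hy

theorem gap_nonneg {x : Point d} (hx : x ∈ domain p W) : 0 ≤ gap p W loss mu x := by
  have hc := (isCompact_domain p hI.isCompact).image_of_continuousOn
    (continuousOn_Fmu (mu := mu) hI.valid hI.regular)
  exact sub_nonneg.2 (csInf_le hc.bddBelow ⟨x, hx, rfl⟩)

/-- The point x' is determined before the index is drawn, so it is fixed while i is averaged. The
momentum estimate then applies to both estimators at once, in the weighted product space. -/
theorem mean_err_step_le (hbeta0 : 0 ≤ beta) (hbeta1 : beta ≤ 1) (hS : S.x ∈ domain p W)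
    {x' : Point d} (hx' : x' = proj (domain p W) (S.x - eta • direction p mu S)) :
    mean (fun i => err p loss (step p W mu eta beta S (loss i)))
      ≤ (1 - beta) * err p loss S + 2 * p.LF ^ 2 * ‖x' - S.x‖ ^ 2
        + 2 * beta ^ 2 * (p.LF ^ 2 * p.sigma ^ 2) := by
  have hmem : x' ∈ domain p W := by
    rw [hx']
    exact (proj_spec (isCompact_domain p hI.isCompact) ⟨_, hS⟩ _).1
  have h := mean_norm_momentum_sub_sq_le hbeta0 hbeta1 (weighted p (estimate S))
    (fun i => weighted p (sample (loss i) S.x)) (fun i => weighted p (sample (loss i) x'))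
    (fun i => norm_weighted_sample_sub_le hI.valid (hI.regular i) hmem hS)
    (mean_norm_weighted_sample_sub_sq_le hI.valid hI.variance hmem)
  refine le_trans (le_of_eq ?_) h
  congr 1
  funext i
  have hx : (step p W mu eta beta S (loss i)).x = x' := hx'.symm
  rw [err, estimate_step, hx, map_add, map_smul, map_sub]

/-- The effect of one run of ASCDRO on the estimator error and on the optimality gap. -/
theorem expectation_ascdro_le (hmu0 : 0 < mu) (hmu1 : mu ≤ 1) (hS : S.x ∈ domain p W)
    (sp : StageParams p.LF p.sigma mu eps eta beta T) :
    expectation (ascdro p W loss mu eta beta T S) (err p loss)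
        ≤ err p loss S / (96 * p.LF ^ 2) + mu * gap p W loss mu S.x / 192 + mu * eps / 192 ∧
      expectation (ascdro p W loss mu eta beta T S) (fun S' => gap p W loss mu S'.x)
        ≤ 26 / 100 * gap p W loss mu S.x
          + 4 / mu * expectation (ascdro p W loss mu eta beta T S) (err p loss) := by
  have hT0 : (0 : ℝ) < T := by linarith [sp.le_T]
  have hT : T ≠ 0 := by
    rintro rfl
    simp at hT0
  have hcpt := isCompact_domain p hI.isCompact
  have hconv := convex_domain p hI.convex
  have hfmu := isStronglyConvexSmooth_Fmu hI hmu0.le hmu1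
  have hLF := hI.valid.LF_pos
  have hb0 := sp.beta_pos
  have he0 := sp.eta_pos
  obtain ⟨y, hy, hgap⟩ := exists_gap_eq (mu := mu) hI.valid hI.regular hI.isCompact ⟨_, hS⟩
  have hmin : ∀ x ∈ domain p W, Fmu p loss mu y ≤ Fmu p loss mu x := fun x hx =>
    sub_nonneg.1 ((gap_nonneg hI hx).trans_eq (hgap x))
  let Λ : (Fin T → Fin n) → ℕ → State d := path p W loss mu eta beta S
  have hmem : ∀ ξ t, (Λ ξ t).x ∈ domain p W := fun ξ t => path_mem_domain hcpt hS t
  have hnext : ∀ ξ, ∀ t < T, (Λ ξ (t + 1)).x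
      = proj (domain p W) ((Λ ξ t).x - eta • direction p mu (Λ ξ t)) := fun ξ t ht => by
    simp only [Λ, path_succ ht]
    rfl
  have hproj : ∀ ξ, ∀ t < T, ∀ w ∈ domain p W,
      ⟪(Λ ξ t).x - eta • direction p mu (Λ ξ t) - (Λ ξ (t + 1)).x, w - (Λ ξ (t + 1)).x⟫ ≤ 0 :=
    fun ξ t ht => by
      rw [hnext ξ t ht]
      exact inner_sub_proj_le_zero hcpt hconv ⟨_, hS⟩ _
  have hdir : ∀ ξ t, ‖direction p mu (Λ ξ t) - gradFmu p loss mu (Λ ξ t).x‖ ^ 2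
      ≤ 2 * err p loss (Λ ξ t) := fun ξ t =>
    norm_direction_sub_gradFmu_sq_le hI.valid hI.regular (hmem ξ t)
  let P : ℕ → ℝ := fun t => mean fun ξ => err p loss (Λ ξ t)
  let D : ℕ → ℝ := fun t => mean fun ξ => ‖(Λ ξ (t + 1)).x - (Λ ξ t).x‖ ^ 2
  let a : ℕ → ℝ := fun t => mean fun ξ => gap p W loss mu (Λ ξ t).x
  let r : ℕ → ℝ := fun t => mean fun ξ => ‖(Λ ξ t).x - y‖ ^ 2
  have hP0 : ∀ t, 0 ≤ P t := fun t => mean_nonneg fun ξ => sq_nonneg _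
  have ha0 : ∀ t, 0 ≤ a t := fun t => mean_nonneg fun ξ => gap_nonneg hI (hmem ξ t)
  have hr0 : ∀ t, 0 ≤ r t := fun t => mean_nonneg fun ξ => sq_nonneg _
  have hP : ∀ t < T, P (t + 1) ≤ (1 - beta) * P t + 2 * p.LF ^ 2 * D t
      + 2 * beta ^ 2 * (p.LF ^ 2 * p.sigma ^ 2) := fun t ht => by
    have h := mean_mono fun ξ : Fin T → Fin n =>
      mean_err_step_le hI hb0.le sp.beta_le (hmem ξ t) (hnext ξ t ht)
    rw [mean_add, mean_add, mean_const, mean_mul_left, mean_mul_left] at h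
    exact (mean_path_succ ht _).trans_le h
  have hD : ∀ t < T, D t ≤ 4 * eta * (a t - a (t + 1)) + 4 * eta ^ 2 * P t := fun t ht => by
    have h := mean_mono fun ξ : Fin T → Fin n =>
      hfmu.norm_step_sq_le (hmem ξ t) (hmem ξ (t + 1)) (hproj ξ t ht) he0 sp.eta_mul_le (hdir ξ t)
    rw [mean_add, mean_mul_left, mean_mul_left] at h
    refine h.trans_eq ?_
    congr 2
    simp only [a, hgap, mean_sub]
    ring
  have ha : ∀ t < T, eta * a (t + 1) ≤ r t - r (t + 1) + 4 * eta / mu * P t := fun t ht => by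
    have h := mean_mono fun ξ : Fin T → Fin n =>
      hfmu.step_gap_le hmu0 (hmem ξ t) (hmem ξ (t + 1)) (hproj ξ t ht) he0 sp.eta_mul_le
        (hdir ξ t) hy hmin
    rw [mean_add, mean_mul_left, mean_mul_left] at h
    simp only [a, r, hgap, mean_sub] at h ⊢
    exact h
  have hPS : P 0 = err p loss S := by simp only [P, Λ, path, mean_const]
  have haS : a 0 = gap p W loss mu S.x := by simp only [a, Λ, path, mean_const]
  have hrS : r 0 = ‖S.x - y‖ ^ 2 := by simp only [r, Λ, path, mean_const]
  have hr : r 0 ≤ 2 / mu * a 0 := by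
    rw [hrS, haS, hgap]
    have h := hfmu.half_mul_norm_sub_minimizer_sq_le hy hmin hS
    rw [div_mul_eq_mul_div, le_div_iff₀ hmu0]
    linarith
  have h1 := sum_error_le sp.eta_sq_le he0 hP0 ha0 hP hD
  have h2 := sum_gap_le he0 ha0 hr0 hr ha
  have hP0' := hP0 0
  have ha0' := ha0 0
  rw [expectation_ascdro hT, expectation_ascdro hT, ← hPS, ← haS]
  change (T : ℝ)⁻¹ * ∑ t ∈ Finset.range T, P t ≤ _ ∧
    (T : ℝ)⁻¹ * ∑ t ∈ Finset.range T, a t ≤ _ + 4 / mu * ((T : ℝ)⁻¹ * ∑ t ∈ Finset.range T, P t)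
  generalize ∑ t ∈ Finset.range T, P t = SP at *
  generalize ∑ t ∈ Finset.range T, a t = SA at *
  generalize P 0 = P₀ at *
  generalize a 0 = a₀ at *
  constructor
  -- After division by βT, the three contributions are the inherited error, the initial gap and the
  -- sampling noise.
  · have e1 : 2 * P₀ ≤ beta * T * (P₀ / (96 * p.LF ^ 2)) := by
      calc 2 * P₀ = 192 * p.LF ^ 2 * (P₀ / (96 * p.LF ^ 2)) := by field_simp; ring
        _ ≤ _ := mul_le_mul_of_nonneg_right sp.le_beta_mul (by positivity)
    have e2 : 16 * p.LF ^ 2 * eta * a₀ ≤ beta * T * (mu * a₀ / 192) := by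
      have := mul_le_mul_of_nonneg_right sp.ratio_le ha0'
      linarith
    have e3 : 4 * beta ^ 2 * (p.LF ^ 2 * p.sigma ^ 2) * T ≤ beta * T * (mu * eps / 192) := by
      have := mul_le_mul_of_nonneg_left sp.beta_sigma_le (by positivity : 0 ≤ beta * T / 192)
      linarith
    rw [inv_mul_le_iff₀ hT0]
    refine le_of_mul_le_mul_left ?_ hb0
    linarith
  -- Here 26/100 = 1/100 + 1/4: the first part comes from T ≥ 100, the second from 2/(μηT) ≤ 1/4.
  · have e1 : eta * a₀ ≤ eta * T * (a₀ / 100) := by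
      have := mul_le_mul_of_nonneg_left sp.le_T (by positivity : 0 ≤ eta * a₀ / 100)
      linarith
    have e2 : 2 / mu * a₀ ≤ eta * T * (a₀ / 4) := by
      have := mul_le_mul_of_nonneg_right sp.le_eta_mul (by positivity : 0 ≤ a₀ / (4 * mu))
      calc 2 / mu * a₀ = 8 * (a₀ / (4 * mu)) := by field_simp; ring
        _ ≤ _ := this
        _ = _ := by field_simp
    have e3 : eta * SA ≤ eta * (T * (26 / 100 * a₀) + 4 / mu * SP) := by
      have : 4 * eta / mu * SP = eta * (4 / mu * SP) := by ring
      linarith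
    have e4 := le_of_mul_le_mul_left e3 he0
    rw [inv_mul_le_iff₀ hT0]
    refine e4.trans_eq ?_
    field_simp

end Stage

/-! ### The stages of RASCDRO -/

section Stages

variable {d n : ℕ} [NeZero n] {p : Params} {W : Set (Weights d)} {loss : Fin n → Weights d → ℝ}
  {mu Δ : ℝ} {x₁ : Point d}
variable (hI : IsRegularInstance p W loss)
include hI

theorem expectation_initial_err_le (hx₁ : x₁ ∈ domain p W) {B : ℕ} (hB : B ≠ 0) :
    expectation (initial loss B x₁) (err p loss) ≤ (B : ℝ)⁻¹ * p.LF ^ 4 := by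
  rw [initial, expectation_uniform_map]
  refine le_trans (le_of_eq ?_) (mul_le_mul_of_nonneg_left
    (mean_norm_weighted_sample_sub_sq_le_LF_pow hI.valid hI.regular hx₁) (by positivity))
  rw [← mean_norm_batch_sub_sq _ hB]
  congr 1
  funext ξ
  rw [← map_sum, ← map_smul, err]
  congr 4
  have h1 : (∑ j, sample (loss (ξ j)) x₁).1 = ∑ j, giGrad (loss (ξ j)) x₁ := by
    simp [sample, Prod.fst_sum]
  have h2 : (∑ j, sample (loss (ξ j)) x₁).2 = ∑ j, gi (loss (ξ j)) x₁ := by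
    simp [sample, Prod.snd_sum]
  have h3 : ∑ j, giGrad (loss (ξ j)) x₁
      = mkPoint (∑ j, giW (loss (ξ j)) x₁) (∑ j, giLam (loss (ξ j)) x₁) := sum_mkPoint _ _ _
  refine Prod.ext ?_ ?_
  · rw [Prod.smul_fst, h1, h3, smul_mkPoint]
    rfl
  · rw [Prod.smul_snd, h2]
    rfl

/-- The state after `k` stages. -/
theorem rascdro_spec (hmu0 : 0 < mu) (hmu : mu ≤ 1 / 2) (hΔ : 0 < Δ) (hx₁ : x₁ ∈ domain p W)
    (hgap : gap p W loss mu x₁ ≤ Δ) (k : ℕ) :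
    (rascdro p W loss mu Δ x₁ k).support.Finite ∧
    (∀ S ∈ (rascdro p W loss mu Δ x₁ k).support, S.x ∈ domain p W) ∧
    expectation (rascdro p W loss mu Δ x₁ k) (fun S => gap p W loss mu S.x) ≤ Δ / 2 ^ k ∧
    expectation (rascdro p W loss mu Δ x₁ k) (err p loss) ≤ mu * (Δ / 2 ^ k) * p.LF ^ 2 := by
  have hLF := hI.valid.one_le_LF
  have hLF2 : 1 ≤ p.LF ^ 2 := one_le_pow₀ hLF
  induction k with
  | zero =>
    have hB : 48 * p.LF ^ 2 / (mu * Δ) ≤ (batchSize p mu Δ : ℝ) := Nat.le_ceil _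
    have hB1 : 0 < 48 * p.LF ^ 2 / (mu * Δ) := by positivity
    have hB0 : batchSize p mu Δ ≠ 0 := by
      intro h
      rw [h, Nat.cast_zero] at hB
      linarith
    have hBpos : (0 : ℝ) < batchSize p mu Δ := hB1.trans_le hB
    rw [rascdro, pow_zero, div_one]
    refine ⟨support_uniform_map_finite _, ?_, ?_, ?_⟩
    · intro S hS
      rw [initial, PMF.mem_support_map_iff] at hS
      obtain ⟨ξ, -, rfl⟩ := hS
      exact hx₁
    · rw [initial, expectation_uniform_map]
      exact mean_le_of_forall_le fun _ => hgap
    -- The crude variance bound L_F⁴ leaves an error of order μΔL_F², hence the factor L_F² in the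
    -- invariant. A stage multiplies the inherited error by 1/(96L_F²), which removes it.
    · refine (expectation_initial_err_le hI hx₁ hB0).trans ?_
      rw [inv_mul_le_iff₀ hBpos]
      calc p.LF ^ 4 ≤ 48 * p.LF ^ 4 := by nlinarith [sq_nonneg (p.LF ^ 2)]
        _ = 48 * p.LF ^ 2 / (mu * Δ) * (mu * Δ * p.LF ^ 2) := by field_simp
        _ ≤ _ := by gcongr
  | succ k ih =>
    obtain ⟨hfin, hdom, hg, he⟩ := ih
    have sp := stageParams hI.valid hmu0 hmu hΔ (k + 1)
    have heps : epsStage Δ (k + 1) = Δ / 2 ^ k := rfl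
    have hT : lenStage p mu Δ (k + 1) ≠ 0 := by
      intro h
      have := sp.le_T
      rw [h, Nat.cast_zero] at this
      linarith
    rw [heps] at sp
    have hε : 0 < Δ / 2 ^ k := by positivity
    have hhalf : Δ / 2 ^ (k + 1) = Δ / 2 ^ k / 2 := by rw [pow_succ, div_div]
    rw [hhalf, rascdro]
    generalize Δ / 2 ^ k = ε at *
    have hstage := fun S hS => expectation_ascdro_le hI hmu0 (by linarith : mu ≤ 1) (hdom S hS) sp
    -- Here ε is the accuracy guaranteed on entering the stage. The contributions are με/96 from the
    -- inherited error, με/192 from the gap and με/192 from the noise.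
    have herr : expectation ((rascdro p W loss mu Δ x₁ k).bind (ascdro p W loss mu
        (etaStage p mu Δ (k + 1)) (betaStage p mu Δ (k + 1)) (lenStage p mu Δ (k + 1))))
        (err p loss) ≤ mu * ε / 48 := by
      rw [expectation_bind hfin fun _ _ => support_ascdro_finite hT]
      have h : expectation (rascdro p W loss mu Δ x₁ k) _ ≤ expectation _ fun S =>
          (96 * p.LF ^ 2)⁻¹ * err p loss S + (mu / 192 * gap p W loss mu S.x + mu * ε / 192) :=
        expectation_mono hfin fun S hS => (hstage S hS).1.trans_eq (by ring)
      rw [expectation_add hfin, expectation_add hfin, expectation_const, expectation_const_mul,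
        expectation_const_mul] at h
      have h1 : (96 * p.LF ^ 2)⁻¹ * expectation (rascdro p W loss mu Δ x₁ k) (err p loss)
          ≤ mu * ε / 96 := by
        rw [inv_mul_le_iff₀ (by positivity)]
        linarith
      have h2 := mul_le_mul_of_nonneg_left hg (by positivity : 0 ≤ mu / 192)
      linarith
    refine ⟨?_, ?_, ?_, ?_⟩
    · rw [PMF.support_bind]
      exact hfin.biUnion fun _ _ => support_ascdro_finite hT
    · intro S hS
      rw [PMF.mem_support_bind_iff] at hS
      obtain ⟨S', hS', h⟩ := hS
      exact mem_domain_of_mem_support_ascdro hT (isCompact_domain p hI.isCompact) (hdom S' hS') h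
    · rw [expectation_bind hfin fun _ _ => support_ascdro_finite hT] at herr ⊢
      have h := expectation_mono hfin fun S hS => (hstage S hS).2
      rw [expectation_add hfin, expectation_const_mul, expectation_const_mul] at h
      have h1 := mul_le_mul_of_nonneg_left herr (by positivity : 0 ≤ 4 / mu)
      -- The new gap is at most (26/100 + 1/12)ε, below ε/2.
      have h2 : 4 / mu * (mu * ε / 48) = ε / 12 := by field_simp; norm_num
      linarith
    · refine herr.trans ?_
      have : 0 < mu * ε := by positivity
      nlinarith

end Stages

/-! ### The oracle complexity -/

theorem sum_three_quarters_pow_le (m : ℕ) :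
    ∑ j ∈ Finset.range (m + 1), (3 / 4 : ℝ) ^ (m - j) ≤ 4 := by
  have h : ∑ j ∈ Finset.range (m + 1), (3 / 4 : ℝ) ^ (m - j)
      = ∑ i ∈ Finset.range (m + 1), (3 / 4 : ℝ) ^ i :=
    Finset.sum_range_reflect (fun i => (3 / 4 : ℝ) ^ i) (m + 1)
  rw [h, geom_sum_eq (by norm_num), div_le_iff_of_neg (by norm_num)]
  have : (0 : ℝ) < (3 / 4) ^ (m + 1) := by positivity
  linarith

/-- Stage j + 1 works at accuracy e ≥ 2^(m-j) ε, so 1/e and 1/√e gain factors 2^-(m-j) and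
2^-((m-j)/2). Both are at most (3/4)^(m-j), because (4/3)² ≤ 2. The term of T_k without ε_k joins
the geometric sequence through 1/μ ≤ Δ/(μe). -/
theorem lenStage_le {p : Params} (hp : p.Valid) {mu Δ ε : ℝ} (hmu0 : 0 < mu) (hmu : mu ≤ 1 / 2)
    (hΔ : 0 < Δ) (hε : 0 < ε) {m j : ℕ} (hm : 2 ^ m * ε ≤ Δ) (hj : j ≤ m) :
    (lenStage p mu Δ (j + 1) : ℝ)
      ≤ (192 * p.c * p.LF * p.sigma + 192 * p.c * p.LF ^ 2 * p.sigma ^ 2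
          + (192 * p.c * p.LF ^ 2 + 1) * Δ)
        * max (1 / (mu * ε)) (1 / (mu ^ (3 / 2 : ℝ) * Real.sqrt ε)) * (3 / 4) ^ (m - j) := by
  have hLF := hp.LF_pos
  have hc := hp.c_pos
  have hs := hp.sigma_pos
  have heps : epsStage Δ (j + 1) = Δ / 2 ^ j := rfl
  rw [lenStage, heps]
  have h2 : (2 : ℝ) ^ m = 2 ^ (m - j) * 2 ^ j := by rw [← pow_add, Nat.sub_add_cancel hj]
  have hlow : 2 ^ (m - j) * ε ≤ Δ / 2 ^ j := by
    rw [le_div_iff₀ (by positivity)]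
    calc _ = 2 ^ m * ε := by rw [h2]; ring
      _ ≤ Δ := hm
  set i := m - j
  set e := Δ / 2 ^ j with he
  have he0 : 0 < e := by positivity
  set Q := max (1 / (mu * ε)) (1 / (mu ^ (3 / 2 : ℝ) * Real.sqrt ε)) with hQ
  have hw : (3 / 4 : ℝ) ^ i * (4 / 3) ^ i = 1 := by
    rw [← mul_pow]; norm_num
  have hw0 : (0 : ℝ) < (3 / 4) ^ i := by positivity
  have hlow1 : (4 / 3) ^ i * ε ≤ e := by
    refine le_trans ?_ hlow
    gcongr
    norm_num
  have hlow2 : (4 / 3) ^ i * Real.sqrt ε ≤ Real.sqrt e := by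
    refine Real.le_sqrt_of_sq_le ?_
    rw [mul_pow, Real.sq_sqrt hε.le, ← pow_mul, mul_comm i 2, pow_mul]
    refine le_trans ?_ hlow
    gcongr
    norm_num
  have hsε := Real.sqrt_pos.2 hε
  have hse := Real.sqrt_pos.2 he0
  have b1 : 1 / (mu ^ (3 / 2 : ℝ) * Real.sqrt e) ≤ Q * (3 / 4) ^ i := by
    have : 1 / (mu ^ (3 / 2 : ℝ) * Real.sqrt e)
        ≤ 1 / (mu ^ (3 / 2 : ℝ) * Real.sqrt ε) * (3 / 4) ^ i := by
      rw [div_mul_eq_mul_div, one_mul, div_le_div_iff₀ (by positivity) (by positivity), one_mul]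
      calc mu ^ (3 / 2 : ℝ) * Real.sqrt ε
          = (3 / 4) ^ i * (mu ^ (3 / 2 : ℝ) * ((4 / 3) ^ i * Real.sqrt ε)) := by
            linear_combination -(mu ^ (3 / 2 : ℝ) * Real.sqrt ε) * hw
        _ ≤ _ := by gcongr
    refine this.trans ?_
    gcongr
    exact le_max_right _ _
  have b2 : 1 / (mu * e) ≤ Q * (3 / 4) ^ i := by
    have : 1 / (mu * e) ≤ 1 / (mu * ε) * (3 / 4) ^ i := by
      rw [div_mul_eq_mul_div, one_mul, div_le_div_iff₀ (by positivity) (by positivity), one_mul]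
      calc mu * ε = (3 / 4) ^ i * (mu * ((4 / 3) ^ i * ε)) := by
            linear_combination -(mu * ε) * hw
        _ ≤ _ := by gcongr
    refine this.trans ?_
    gcongr
    exact le_max_left _ _
  have b3 : 1 / mu ≤ Δ * (Q * (3 / 4) ^ i) := by
    have he1 : e ≤ Δ := div_le_self hΔ.le (one_le_pow₀ (by norm_num))
    calc 1 / mu = e * (1 / (mu * e)) := by field_simp
      _ ≤ _ := by gcongr
  -- The 1 lost in rounding up is charged to 1/μ.
  have b4 : 1 ≤ 1 / mu := by
    rw [le_div_iff₀ hmu0]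
    linarith
  refine (Nat.ceil_lt_add_one (by positivity)).le.trans ?_
  set w := Q * (3 / 4) ^ i with hwdef
  have hw1 : 0 ≤ w := by positivity
  have c1 : 192 * p.c * p.LF * p.sigma / (mu ^ (3 / 2 : ℝ) * Real.sqrt e)
      ≤ 192 * p.c * p.LF * p.sigma * w := by
    rw [div_eq_mul_one_div]
    gcongr
  have c2 : 192 * p.c * p.LF ^ 2 * p.sigma ^ 2 / (mu * e)
      ≤ 192 * p.c * p.LF ^ 2 * p.sigma ^ 2 * w := by
    rw [div_eq_mul_one_div]
    gcongr
  have c3 : 192 * p.c * p.LF ^ 2 / mu ≤ 192 * p.c * p.LF ^ 2 * (Δ * w) := by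
    rw [div_eq_mul_one_div]
    gcongr
  have n1 : 0 ≤ 192 * p.c * p.LF * p.sigma * w := by positivity
  have n2 : 0 ≤ 192 * p.c * p.LF ^ 2 * p.sigma ^ 2 * w := by positivity
  have n3 : 0 ≤ 192 * p.c * p.LF ^ 2 * (Δ * w) := by positivity
  have hmax := max_le (c1.trans (by linarith : _ ≤ 192 * p.c * p.LF * p.sigma * w
    + 192 * p.c * p.LF ^ 2 * p.sigma ^ 2 * w + 192 * p.c * p.LF ^ 2 * (Δ * w)))
    (max_le (c2.trans (by linarith)) (c3.trans (by linarith)))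
  rw [mul_assoc _ Q, ← hwdef]
  linarith

theorem oracleCalls_le {p : Params} (hp : p.Valid) {mu Δ ε : ℝ} (hmu0 : 0 < mu) (hmu : mu ≤ 1 / 2)
    (hΔ : 0 < Δ) (hε : 0 < ε) {m : ℕ} (hm : 2 ^ m * ε ≤ Δ) :
    (oracleCalls p mu Δ (m + 1) : ℝ)
      ≤ (4 * (192 * p.c * p.LF * p.sigma + 192 * p.c * p.LF ^ 2 * p.sigma ^ 2
          + (192 * p.c * p.LF ^ 2 + 1) * Δ) + (48 * p.LF ^ 2 + Δ))
        * max (1 / (mu * ε)) (1 / (mu ^ (3 / 2 : ℝ) * Real.sqrt ε)) := by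
  have hLF := hp.LF_pos
  have hc := hp.c_pos
  have hs := hp.sigma_pos
  have hεΔ : ε ≤ Δ := le_trans (le_mul_of_one_le_left hε.le (one_le_pow₀ (by norm_num))) hm
  set Q := max (1 / (mu * ε)) (1 / (mu ^ (3 / 2 : ℝ) * Real.sqrt ε)) with hQ
  set A := 192 * p.c * p.LF * p.sigma + 192 * p.c * p.LF ^ 2 * p.sigma ^ 2
    + (192 * p.c * p.LF ^ 2 + 1) * Δ with hA
  have hQ0 : 0 ≤ Q := le_max_of_le_left (by positivity)
  have hA0 : 0 ≤ A := by positivity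
  have hbatch : (batchSize p mu Δ : ℝ) ≤ (48 * p.LF ^ 2 + Δ) * Q := by
    refine (Nat.ceil_lt_add_one (by positivity)).le.trans ?_
    calc 48 * p.LF ^ 2 / (mu * Δ) + 1 ≤ 48 * p.LF ^ 2 / (mu * ε) + Δ / (mu * ε) := by
          gcongr
          rw [le_div_iff₀ (by positivity)]
          nlinarith
      _ = (48 * p.LF ^ 2 + Δ) * (1 / (mu * ε)) := by ring
      _ ≤ _ := by
          gcongr
          exact le_max_left _ _
  have hsum : ((∑ k ∈ Finset.Icc 1 (m + 1), lenStage p mu Δ k : ℕ) : ℝ) ≤ 4 * A * Q := by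
    have hre : ∑ k ∈ Finset.Icc 1 (m + 1), lenStage p mu Δ k
        = ∑ j ∈ Finset.range (m + 1), lenStage p mu Δ (j + 1) := by
      rw [Finset.range_eq_Ico, Finset.sum_Ico_add' (fun k => lenStage p mu Δ k) 0 (m + 1) 1]
      rfl
    rw [hre, Nat.cast_sum]
    calc _ ≤ ∑ j ∈ Finset.range (m + 1), A * Q * (3 / 4) ^ (m - j) :=
          Finset.sum_le_sum fun j hj => lenStage_le hp hmu0 hmu hΔ hε hm
            (Nat.lt_succ_iff.1 (Finset.mem_range.1 hj))
      _ ≤ A * Q * 4 := by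
          rw [← Finset.mul_sum]
          exact mul_le_mul_of_nonneg_left (sum_three_quarters_pow_le m) (by positivity)
      _ = 4 * A * Q := by ring
  rw [oracleCalls, Nat.cast_add]
  linarith

end DRO

theorem mainTheorem4 :
    ∃ A₁ : ℝ, 0 < A₁ ∧
    ∀ (p : DRO.Params) (Δ : ℝ), p.Valid → 0 < Δ →
    ∃ A₂ : ℝ, 0 < A₂ ∧
    ∀ (d n : ℕ) [NeZero n] (R : ℝ) (W : Set (DRO.Weights d))
      (loss : Fin n → DRO.Weights d → ℝ) (x₁ : DRO.Point d),
      DRO.LossAssumption p R W loss →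
      DRO.VarianceAssumption p W loss →
      (∀ i, ConvexOn ℝ W (loss i)) →
      x₁ ∈ DRO.domain p W →
    ∀ μ ε : ℝ, 0 < μ → μ ≤ 1 / 2 →
      DRO.gap p W loss μ x₁ ≤ Δ →
      0 < ε → ε ≤ Δ →
    ∃ K : ℕ, 1 ≤ K ∧ (K : ℝ) ≤ A₁ * (1 + Real.logb 2 (Δ / ε)) ∧
      DRO.expectation (DRO.rascdro p W loss μ Δ x₁ K) (fun S => DRO.gap p W loss μ S.x) ≤ ε ∧
      (DRO.oracleCalls p μ Δ K : ℝ) ≤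
        A₂ * max (1 / (μ * ε)) (1 / (μ ^ (3 / 2 : ℝ) * Real.sqrt ε)) := by
  refine ⟨1, one_pos, fun p Δ hp hΔ => ?_⟩
  have hLF := hp.LF_pos
  have hc := hp.c_pos
  have hs := hp.sigma_pos
  refine ⟨4 * (192 * p.c * p.LF * p.sigma + 192 * p.c * p.LF ^ 2 * p.sigma ^ 2
    + (192 * p.c * p.LF ^ 2 + 1) * Δ) + (48 * p.LF ^ 2 + Δ), by positivity, ?_⟩
  intro d n _ R W loss x₁ hA hV hconv hx₁ μ ε hμ0 hμ hgap hε hεΔ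
  have hI : DRO.IsRegularInstance p W loss :=
    { valid := hp
      convex := hA.convex
      isCompact := Metric.isCompact_of_isClosed_isBounded hA.closed
        (Bornology.IsBounded.subset Metric.isBounded_closedBall fun w hw =>
          mem_closedBall_zero_iff.2 (hA.bounded w hw))
      regular := hA.isRegularLoss hconv
      variance := hV }
  -- With 2^m ≤ Δ/ε < 2^(m+1), the choice K = m + 1 reaches accuracy ε. The lower inequality gives K
  -- ≤ 1 + log₂(Δ/ε), so A₁ = 1 suffices, and it is also what the cost bound requires.
  obtain ⟨m, hm1, hm2⟩ := exists_nat_pow_near ((one_le_div hε).2 hεΔ) (one_lt_two (α := ℝ))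
  have hm : 2 ^ m * ε ≤ Δ := (le_div_iff₀ hε).1 hm1
  refine ⟨m + 1, by omega, ?_, ?_, DRO.oracleCalls_le hp hμ0 hμ hΔ hε hm⟩
  · have h : (m : ℝ) ≤ Real.logb 2 (Δ / ε) := by
      rw [Real.le_logb_iff_rpow_le one_lt_two (by positivity), Real.rpow_natCast]
      exact hm1
    push_cast
    linarith
  · refine (DRO.rascdro_spec hI hμ0 hμ hΔ hx₁ hgap (m + 1)).2.2.1.trans ?_
    rw [div_le_iff₀ (by positivity), mul_comm]
    exact ((div_lt_iff₀ hε).1 hm2).le
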